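/- Let $k\ge 2$ be an integer. For a finite simple graph $F$, a $k$-uniform hypergraph $H$ (a finite vertex set with a set of $k$-element subsets, called hyperedges) is \emph{Berge-$F$} if $F$ can be embedded injectively on the vertex set of $H$ so that there is a bijection $\phi:E(F)\to E(H)$ with $e\subseteq\phi(e)$ for every $e\in E(F)$; the hyperedges may use further vertices. A $k$-uniform hypergraph $H$ is \emph{Berge-$F$-saturated} if no subhypergraph of $H$ is Berge-$F$, but for every $k$-element set $e\subseteq V(H)$ with $e\notin E(H)$, the hypergraph $H+e$ has a Berge-$F$ subhypergraph. Let $\mathrm{sat}_k(n,\text{Berge-}F)$ be the minimum number of hyperedges in a Berge-$F$-saturated $k$-uniform hypergraph on $n$ vertices. \textbf{Theorem.} Let $F$ be a finite simple graph with at least one edge and let $k\in\{3,4,5\}$. Then for every $n$ there is a Berge-$F$-saturated $k$-uniform hypergraph on $n$ vertices, and $$\mathrm{sat}_k(n,\text{Berge-}F)=O(n)\qquad (n\to\infty),$$ where the implied constant depends only on $F$ and $k$. -/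

import Mathlib

open Filter Asymptotics

/-- A `k`-uniform hypergraph with vertex set `V`, given by its finite set of hyperedges. -/
@[ext]
structure UniformHypergraph (k : ℕ) (V : Type*) where
  edges : Finset (Finset V)
  uniform : ∀ e ∈ edges, e.card = k

namespace UniformHypergraph

variable {k : ℕ} {V W : Type*}

/-- `H'` is a subhypergraph of `H` (on the same vertex set): each hyperedge of `H'` is one of `H`. -/
def IsSubhypergraph (H' H : UniformHypergraph k V) : Prop :=
  H'.edges ⊆ H.edges

/-- The hypergraph `H + e` obtained from `H` by adding the `k`-edge `e`. -/
def addEdge [DecidableEq V] (H : UniformHypergraph k V) (e : Finset V) (he : e.card = k) :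
    UniformHypergraph k V where
  edges := insert e H.edges
  uniform := by
    intro f hf
    rcases Finset.mem_insert.mp hf with rfl | hf
    · exact he
    · exact H.uniform f hf

/-- `H` is Berge-`F`: the graph `F` can be embedded on the vertex set of `H` (by an injection `f`)
so that some bijection `φ` from the edges of `F` to the hyperedges of `H` sends each edge of `F` to
a hyperedge containing both (embedded) endpoints. The hyperedges may use further vertices. -/
def IsBerge (F : SimpleGraph W) (H : UniformHypergraph k V) : Prop :=
  ∃ (f : W ↪ V) (φ : F.edgeSet ≃ H.edges), ∀ (e : F.edgeSet) (w : W),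
    w ∈ (e : Sym2 W) → f w ∈ (φ e : Finset V)

/-- `H` contains a copy of a Berge-`F`. -/
def ContainsBerge (F : SimpleGraph W) (H : UniformHypergraph k V) : Prop :=
  ∃ H' : UniformHypergraph k V, H'.IsSubhypergraph H ∧ H'.IsBerge F

/-- `H` is Berge-`F`-saturated: `H` contains no Berge-`F`, but adding any new `k`-edge on the
vertex set of `H` creates a Berge-`F`. -/
def IsBergeSaturated [DecidableEq V] (F : SimpleGraph W) (H : UniformHypergraph k V) : Prop :=
  ¬ H.ContainsBerge F ∧
    ∀ (e : Finset V) (he : e.card = k), e ∉ H.edges → (H.addEdge e he).ContainsBerge F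

end UniformHypergraph

/-- The saturation number `sat_k(n, Berge-F)`: the minimum number of hyperedges of a
Berge-`F`-saturated `k`-uniform hypergraph on `n` vertices. (It is `0` by convention if there is no
such hypergraph.) -/
noncomputable def bergeSat {W : Type*} (k n : ℕ) (F : SimpleGraph W) : ℕ :=
  sInf {m : ℕ | ∃ H : UniformHypergraph k (Fin n), H.IsBergeSaturated F ∧ H.edges.card = m}

/-!
A Berge-`F`-free hypergraph extends greedily to a saturated one, so it suffices to find a
Berge-`F`-free hypergraph of which every extension with many hyperedges contains a Berge-`F`. An
extension with far more than linearly many hyperedges has a vertex set in which each vertex has many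
co-neighbours, and forests embed there leaf by leaf. If `A` is a feedback vertex set of `F`, it is
thus enough that the starting hypergraph has vertices onto which `A` can be placed so that the edges
of `F` meeting `A` find hyperedges of their own.

A petal system provides this: `t ≥ |A|` core vertices, a hyperedge through each pair of them, and
kernels of `r` core vertices, each joined to every one of linearly many disjoint petals of
`s = k - r` vertices. It contains a Berge-`F` only if the `2`-core of `F` is, up to at most `t`
vertices, a union of small parts lying in single petals, with few edges each. Let `a < c` be the
minimum sizes of a feedback vertex set and of a vertex cover of the `2`-core. The kernels can be
chosen so as to preclude such a decomposition: for `a ≤ 2` take single vertices and `t = a`; for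
`c > k` take `s = 1` and `t = c - 1`; otherwise `k ≤ 5` leaves `a` equal to `3` or `4` (`c < 2a`).
There `r = a - 1` and `t = a` work, since a decomposition would either isolate a triangle in the
`2`-core or yield `a` disjoint triangles, each meeting every vertex cover twice. If the `2`-core has
a triangle component, then `a = 3` and `c = k = 5`, and two triples among four core vertices do.
-/

open scoped Finset

/-- The pairs in `E`, placed on `V` by `f`, have pairwise distinct hyperedges of `𝓔` containing
them. A hypergraph contains a Berge-`F` when this holds for its hyperedges, the edges of `F` and
some injection `f`; stating it for sets of edges allows copies of `F` to be assembled from parts. -/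
def Realizes {V W : Type*} (𝓔 : Set (Finset V)) (E : Set (Sym2 W)) (f : W → V) : Prop :=
  ∃ g : Sym2 W → Finset V, Set.InjOn g E ∧ ∀ e ∈ E, g e ∈ 𝓔 ∧ ∀ w ∈ e, f w ∈ g e

section Realizes

variable {V W : Type*} {𝓔 𝓔₁ 𝓔₂ : Set (Finset V)} {E E₁ E₂ : Set (Sym2 W)} {f f' : W → V}

theorem realizes_empty_right : Realizes 𝓔 ∅ f :=
  ⟨fun _ => ∅, Set.injOn_empty _, by simp⟩

theorem realizes_singleton_left {d : Finset V} (hE : E.Subsingleton)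
    (hd : ∀ e ∈ E, ∀ w ∈ e, f w ∈ d) : Realizes {d} E f :=
  ⟨fun _ => d, fun _ he _ he' _ => hE he he', fun e he => ⟨rfl, hd e he⟩⟩

theorem realizes_image {ι : Type*} {I : Set ι} {φ : ι → Sym2 W} {h : ι → Finset V}
    (hinj : I.InjOn h) (hmem : ∀ i ∈ I, ∀ w ∈ φ i, f w ∈ h i) :
    Realizes (h '' I) (φ '' I) f := by
  rcases I.eq_empty_or_nonempty with rfl | ⟨i, -⟩
  · simpa only [Set.image_empty] using realizes_empty_right
  have : Nonempty ι := ⟨i⟩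
  have hsurj : ∀ e ∈ φ '' I, ∃ i ∈ I, φ i = e := fun _ he => he
  choose! σ hσI hσ using hsurj
  refine ⟨h ∘ σ, fun e he e' he' hee' => ?_, fun e he => ⟨⟨σ e, hσI e he, rfl⟩, fun w hw => ?_⟩⟩
  · rw [← hσ e he, ← hσ e' he', hinj (hσI e he) (hσI e' he') hee']
  · exact hmem _ (hσI e he) w (by rwa [hσ e he])

theorem Realizes.mono_left_of_forall (h : Realizes 𝓔₁ E f)
    (h𝓔 : ∀ d ∈ 𝓔₁, ∀ e ∈ E, (∀ w ∈ e, f w ∈ d) → d ∈ 𝓔₂) : Realizes 𝓔₂ E f := by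
  obtain ⟨g, hinj, hg⟩ := h
  exact ⟨g, hinj, fun e he => ⟨h𝓔 _ (hg e he).1 e he (hg e he).2, (hg e he).2⟩⟩

theorem Realizes.mono (h : Realizes 𝓔₁ E₁ f) (h𝓔 : 𝓔₁ ⊆ 𝓔₂) (hE : E₂ ⊆ E₁) :
    Realizes 𝓔₂ E₂ f := by
  obtain ⟨g, hinj, hg⟩ := h
  exact ⟨g, hinj.mono hE, fun e he => ⟨h𝓔 (hg e (hE he)).1, (hg e (hE he)).2⟩⟩

theorem Realizes.congr (h : Realizes 𝓔 E f) (hf : ∀ e ∈ E, ∀ w ∈ e, f w = f' w) :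
    Realizes 𝓔 E f' := by
  obtain ⟨g, hinj, hg⟩ := h
  exact ⟨g, hinj, fun e he => ⟨(hg e he).1, fun w hw => hf e he w hw ▸ (hg e he).2 w hw⟩⟩

theorem Realizes.union (h₁ : Realizes 𝓔₁ E₁ f) (h₂ : Realizes 𝓔₂ E₂ f) (hd : Disjoint 𝓔₁ 𝓔₂) :
    Realizes (𝓔₁ ∪ 𝓔₂) (E₁ ∪ E₂) f := by
  classical
  obtain ⟨g₁, hinj₁, hg₁⟩ := h₁
  obtain ⟨g₂, hinj₂, hg₂⟩ := h₂
  have hmem₂ : ∀ e ∈ E₁ ∪ E₂, e ∉ E₁ → e ∈ E₂ := fun e he he₁ => he.resolve_left he₁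
  refine ⟨E₁.piecewise g₁ g₂, fun e he e' he' hee' => ?_, fun e he => ?_⟩
  · by_cases h : e ∈ E₁ <;> by_cases h' : e' ∈ E₁ <;>
      simp only [Set.piecewise, h, h', if_true, if_false] at hee'
    · exact hinj₁ h h' hee'
    · exact (hd.ne_of_mem (hg₁ e h).1 (hg₂ e' (hmem₂ e' he' h')).1 hee').elim
    · exact (hd.ne_of_mem (hg₁ e' h').1 (hg₂ e (hmem₂ e he h)).1 hee'.symm).elim
    · exact hinj₂ (hmem₂ e he h) (hmem₂ e' he' h') hee'
  · by_cases h : e ∈ E₁ <;> simp only [Set.piecewise, h, if_true, if_false]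
    · exact ⟨Or.inl (hg₁ e h).1, (hg₁ e h).2⟩
    · exact ⟨Or.inr (hg₂ e (hmem₂ e he h)).1, (hg₂ e (hmem₂ e he h)).2⟩

end Realizes

namespace UniformHypergraph

variable {k : ℕ} {V W : Type*} {F : SimpleGraph W} {H : UniformHypergraph k V}

theorem containsBerge_iff_realizes :
    H.ContainsBerge F ↔ ∃ f : W ↪ V, Realizes H.edges F.edgeSet f := by
  classical
  constructor
  · rintro ⟨H', hsub, f, φ, hφ⟩
    refine ⟨f, fun e => if h : e ∈ F.edgeSet then (φ ⟨e, h⟩ : Finset V) else ∅, ?_, ?_⟩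
    · intro a ha b hb hab
      simp only [ha, hb, dite_true] at hab
      simpa using φ.injective (Subtype.ext hab)
    · intro e he
      simp only [he, dite_true]
      exact ⟨hsub (φ ⟨e, he⟩).2, hφ ⟨e, he⟩⟩
  · rintro ⟨f, g, hinj, hg⟩
    let H' : UniformHypergraph k V :=
      { edges := {d ∈ H.edges | ∃ e ∈ F.edgeSet, g e = d}
        uniform := fun d hd => H.uniform d (Finset.mem_filter.mp hd).1 }
    have hφ : Function.Bijective (fun e : F.edgeSet =>
        (⟨g e, Finset.mem_filter.mpr ⟨(hg e e.2).1, e, e.2, rfl⟩⟩ : H'.edges)) := by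
      refine ⟨fun a b hab => Subtype.ext (hinj a.2 b.2 (congrArg Subtype.val hab)), ?_⟩
      rintro ⟨d, hd⟩
      obtain ⟨e, he, rfl⟩ := (Finset.mem_filter.mp hd).2
      exact ⟨⟨e, he⟩, rfl⟩
    exact ⟨H', Finset.filter_subset _ _, f, Equiv.ofBijective _ hφ, fun e => (hg e e.2).2⟩

theorem not_containsBerge_of_edges_eq_empty (hF : F ≠ ⊥) (hH : H.edges = ∅) :
    ¬ H.ContainsBerge F := by
  rw [containsBerge_iff_realizes]
  rintro ⟨f, g, -, hg⟩
  obtain ⟨e, he⟩ := SimpleGraph.edgeSet_nonempty.mpr hF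
  simpa [hH] using (hg e he).1

theorem exists_isBergeSaturated_of_not_containsBerge [Finite V] [DecidableEq V]
    (hH : ¬ H.ContainsBerge F) :
    ∃ H' : UniformHypergraph k V, H.IsSubhypergraph H' ∧ H'.IsBergeSaturated F := by
  let free : Set (Finset (Finset V)) :=
    {E | ∃ H : UniformHypergraph k V, H.edges = E ∧ ¬ H.ContainsBerge F}
  obtain ⟨E, hE, hmax⟩ := free.toFinite.exists_le_maximal (a := H.edges) ⟨H, rfl, hH⟩
  obtain ⟨H', rfl, hH'⟩ := hmax.prop
  refine ⟨H', hE, hH', fun e he hne => ?_⟩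
  by_contra hcon
  exact hne (hmax.le_of_ge (y := (H'.addEdge e he).edges) ⟨_, rfl, hcon⟩
    (Finset.subset_insert _ _) (Finset.mem_insert_self _ _))

end UniformHypergraph

/-! ### Dense vertex sets -/

namespace UniformHypergraph

variable {k M : ℕ} {V : Type*} {H : UniformHypergraph k V}

open Classical in
/-- The vertices of `U` lying in a common hyperedge of `H` with `u`. The remaining vertices of that
hyperedge need not belong to `U`, and `u` itself is allowed. -/
noncomputable def coNeighbors (H : UniformHypergraph k V) (U : Finset V) (u : V) : Finset V :=
  {w ∈ U | ∃ e ∈ H.edges, u ∈ e ∧ w ∈ e}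

theorem mem_coNeighbors {U : Finset V} {u w : V} :
    w ∈ H.coNeighbors U u ↔ w ∈ U ∧ ∃ e ∈ H.edges, u ∈ e ∧ w ∈ e := by
  simp only [coNeighbors, Finset.mem_filter]

theorem card_filter_subset_union_le [DecidableEq V] {X Y : Finset V}
    (hsparse : ∀ U ⊆ Y, U.Nonempty → ∃ u ∈ U, #(H.coNeighbors U u) ≤ M) :
    #{e ∈ H.edges | e ⊆ X ∪ Y} ≤ 2 ^ (#X + M) * (#Y + 1) := by
  induction Y using Finset.strongInduction with
  | H Y ih =>
    rcases Y.eq_empty_or_nonempty with rfl | hY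
    · calc #{e ∈ H.edges | e ⊆ X ∪ ∅} ≤ #X.powerset :=
            Finset.card_le_card fun e he => by simpa using (Finset.mem_filter.mp he).2
        _ ≤ 2 ^ (#X + M) * (#(∅ : Finset V) + 1) := by
            rw [Finset.card_powerset, Finset.card_empty, zero_add, mul_one]
            exact Nat.pow_le_pow_right two_pos (Nat.le_add_right _ _)
    obtain ⟨u, hu, hM⟩ := hsparse Y subset_rfl hY
    have hsplit : {e ∈ H.edges | e ⊆ X ∪ Y} ⊆
        {e ∈ H.edges | e ⊆ X ∪ Y.erase u} ∪ (X ∪ H.coNeighbors Y u).powerset := by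
      intro e he
      obtain ⟨heH, heY⟩ := Finset.mem_filter.mp he
      by_cases hue : u ∈ e
      · refine Finset.mem_union_right _ (Finset.mem_powerset.mpr fun w hw => ?_)
        exact Finset.mem_union.mpr
          ((Finset.mem_union.mp (heY hw)).imp_right fun hwY =>
            mem_coNeighbors.mpr ⟨hwY, e, heH, hue, hw⟩)
      · refine Finset.mem_union_left _ (Finset.mem_filter.mpr ⟨heH, fun w hw => ?_⟩)
        exact Finset.mem_union.mpr ((Finset.mem_union.mp (heY hw)).imp_right
          (Finset.mem_erase.mpr ⟨ne_of_mem_of_not_mem hw hue, ·⟩))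
    have hcard : #(X ∪ H.coNeighbors Y u) ≤ #X + M :=
      (Finset.card_union_le _ _).trans (Nat.add_le_add_left hM _)
    calc #{e ∈ H.edges | e ⊆ X ∪ Y}
        ≤ #{e ∈ H.edges | e ⊆ X ∪ Y.erase u} + #(X ∪ H.coNeighbors Y u).powerset :=
          (Finset.card_le_card hsplit).trans (Finset.card_union_le _ _)
      _ ≤ 2 ^ (#X + M) * (#(Y.erase u) + 1) + 2 ^ (#X + M) := by
          rw [Finset.card_powerset]
          exact Nat.add_le_add
            (ih _ (Finset.erase_ssubset hu) fun U hU => hsparse U (hU.trans (Y.erase_subset u)))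
            (Nat.pow_le_pow_right two_pos hcard)
      _ = 2 ^ (#X + M) * (#Y + 1) := by
          rw [Finset.card_erase_add_one hu, Nat.mul_succ]

theorem exists_forall_lt_card_coNeighbors [Fintype V] [DecidableEq V] {Y : Finset V}
    (hH : 2 ^ (#Yᶜ + M) * (#Y + 1) < #H.edges) :
    ∃ U ⊆ Y, U.Nonempty ∧ ∀ u ∈ U, M < #(H.coNeighbors U u) := by
  by_contra! hcon
  refine hH.not_ge ?_
  calc #H.edges = #{e ∈ H.edges | e ⊆ Yᶜ ∪ Y} := by
        rw [Finset.filter_true_of_mem fun e _ => by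
          rw [Finset.union_comm, Finset.union_compl]; exact e.subset_univ]
    _ ≤ 2 ^ (#Yᶜ + M) * (#Y + 1) := card_filter_subset_union_le hcon

end UniformHypergraph

/-! ### Forests in dense hypergraphs -/

/-- The subgraph of `F` induced by `Y` has minimum degree at least two (or `Y` is empty). The
largest such set, characterised by `IsGreatest {Y | InducesMinDegTwo F Y}`, is the `2`-core. -/
def InducesMinDegTwo {W : Type*} (F : SimpleGraph W) (Y : Finset W) : Prop :=
  ∀ y ∈ Y, (↑Y ∩ F.neighborSet y).Nontrivial

/-- Deleting `A` from `F` leaves a forest, phrased by the absence of nonempty induced subgraphs of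
minimum degree two. -/
def IsFeedbackVertexSet {W : Type*} (F : SimpleGraph W) (A : Finset W) : Prop :=
  ∀ Y, InducesMinDegTwo F Y → Disjoint Y A → Y = ∅

/-- A Berge-copy of `F[T]` in which the vertices lie in `U` and have distinct labels. All vertices
of the hyperedges used have labels in `Λ`, so hyperedges with a vertex labelled outside `Λ` are
still available. -/
structure IsForestEmbedding {k : ℕ} {V W L : Type*} (F : SimpleGraph W)
    (H : UniformHypergraph k V) (U : Finset V) (l : V → L) (T : Finset W) (Λ : Finset L)
    (f : W → V) : Prop where
  mapsTo : ∀ w ∈ T, f w ∈ U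
  injOn : Set.InjOn (l ∘ f) T
  label_mem : ∀ w ∈ T, l (f w) ∈ Λ
  realizes : Realizes {d | d ∈ H.edges ∧ ∀ v ∈ d, l v ∈ Λ} (F.edgeSet ∩ T.sym2) f

section Forests

variable {k s : ℕ} {V W L : Type*} {F : SimpleGraph W} {H : UniformHypergraph k V}
  {U : Finset V} {l : V → L} {T : Finset W} {Λ : Finset L} {f : W → V}

theorem exists_neighborSet_inter_subsingleton (hT : ¬ InducesMinDegTwo F T) :
    ∃ y ∈ T, (↑T ∩ F.neighborSet y).Subsingleton := by
  simpa only [InducesMinDegTwo, not_forall, Set.not_nontrivial_iff, exists_prop] using hT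

theorem Realizes.insert_leaf [DecidableEq W] {𝓔 : Set (Finset V)}
    (h : Realizes 𝓔 (F.edgeSet ∩ T.sym2) f) {y : W} {w : V} {d : Finset V} (hy : y ∉ T)
    (hleaf : (↑T ∩ F.neighborSet y).Subsingleton) (hd : d ∉ 𝓔)
    (hx : ∀ x ∈ T, F.Adj y x → f x ∈ d) (hwd : w ∈ d) :
    Realizes (insert d 𝓔) (F.edgeSet ∩ (insert y T).sym2) (Function.update f y w) := by
  have hfT : ∀ x ∈ T, Function.update f y w x = f x := fun x hx =>
    Function.update_of_ne (ne_of_mem_of_not_mem hx hy) _ _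
  have hold : Realizes 𝓔 (F.edgeSet ∩ T.sym2) (Function.update f y w) :=
    h.congr fun e he x hxe => (hfT x (Finset.mem_sym2_iff.mp he.2 x hxe)).symm
  have hnew : Realizes {d} {e | e ∈ F.edgeSet ∧ ∃ x ∈ T, e = s(y, x)} (Function.update f y w) := by
    refine realizes_singleton_left ?_ ?_
    · rintro _ ⟨he, x, hxT, rfl⟩ _ ⟨he', x', hxT', rfl⟩
      rw [hleaf ⟨hxT, he⟩ ⟨hxT', he'⟩]
    · rintro _ ⟨he, x, hxT, rfl⟩ z hz
      rcases Sym2.mem_iff.mp hz with rfl | rfl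
      · rwa [Function.update_self]
      · exact hfT z hxT ▸ hx z hxT he
  refine (hnew.union hold (Set.disjoint_singleton_left.mpr hd)).mono subset_rfl ?_
  rintro e ⟨he, heT⟩
  rw [Finset.mem_coe, Finset.mem_sym2_iff] at heT
  by_cases hye : y ∈ e
  · obtain ⟨x, rfl⟩ := hye
    exact Or.inl ⟨he, x, Finset.mem_of_mem_insert_of_ne (heT x (Sym2.mem_mk_right y x))
      (F.ne_of_adj he).symm, rfl⟩
  · exact Or.inr ⟨he, Finset.mem_sym2_iff.mpr fun x hxe =>
      Finset.mem_of_mem_insert_of_ne (heT x hxe) (ne_of_mem_of_not_mem hxe hye)⟩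

theorem IsForestEmbedding.insert [DecidableEq W] [DecidableEq L]
    (h : IsForestEmbedding F H U l T Λ f) {y : W} {w : V} {d : Finset V} (hy : y ∉ T)
    (hleaf : (↑T ∩ F.neighborSet y).Subsingleton) (hd : d ∈ H.edges)
    (hx : ∀ x ∈ T, F.Adj y x → f x ∈ d) (hwd : w ∈ d) (hwU : w ∈ U) (hlw : l w ∉ Λ) :
    IsForestEmbedding F H U l (insert y T) (Λ ∪ d.image l) (Function.update f y w) := by
  set f' := Function.update f y w
  have hfy : f' y = w := Function.update_self ..
  have hfT : ∀ x ∈ T, f' x = f x := fun x hx =>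
    Function.update_of_ne (ne_of_mem_of_not_mem hx hy) _ _
  have hlwd : l w ∈ Λ ∪ d.image l :=
    Finset.mem_union_right _ (Finset.mem_image_of_mem l hwd)
  have hnew : ∀ x ∈ T, l (f' x) ≠ l w := fun x hxT hlx =>
    hlw (hlx ▸ hfT x hxT ▸ h.label_mem x hxT)
  refine ⟨?_, ?_, ?_, ?_⟩
  · exact Finset.forall_mem_insert .. |>.mpr ⟨hfy ▸ hwU, fun x hx => hfT x hx ▸ h.mapsTo x hx⟩
  · rw [Finset.coe_insert, Set.injOn_insert (by simpa using hy)]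
    refine ⟨h.injOn.congr fun x hx => by simp only [Function.comp_apply, hfT x hx], ?_⟩
    rintro ⟨x, hxT, hlx⟩
    exact hnew x hxT (by simpa only [Function.comp_apply, hfy] using hlx)
  · exact Finset.forall_mem_insert .. |>.mpr ⟨hfy ▸ hlwd, fun x hx =>
      Finset.mem_union_left _ (hfT x hx ▸ h.label_mem x hx)⟩
  refine (h.realizes.insert_leaf hy hleaf (fun hdΛ => hlw (hdΛ.2 w hwd)) hx hwd).mono ?_ subset_rfl
  rintro d' (rfl | ⟨hd', hΛ⟩)
  · exact ⟨hd, fun v hv => Finset.mem_union_right _ (Finset.mem_image_of_mem l hv)⟩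
  · exact ⟨hd', fun v hv => Finset.mem_union_left _ (hΛ v hv)⟩

theorem exists_mem_label_notMem [DecidableEq L] {X : Finset V} (hXU : X ⊆ U)
    (hl : ∀ c, #{v ∈ U | l v = c} ≤ s) (hX : s * #Λ < #X) : ∃ w ∈ X, l w ∉ Λ := by
  by_contra! hused
  exact hX.not_ge <| Finset.card_le_mul_card_image_of_maps_to hused s fun c _ =>
    (Finset.card_le_card (Finset.filter_subset_filter _ hXU)).trans (hl c)

/-- A forest is embedded leaf by leaf: the image of the only neighbour of the new leaf has more
co-neighbours than there are vertices of `U` with a label that is already in use. -/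
theorem exists_isForestEmbedding [DecidableEq L]
    (hT : ∀ Y ⊆ T, InducesMinDegTwo F Y → Y = ∅) (hU : U.Nonempty)
    (hl : ∀ c, #{v ∈ U | l v = c} ≤ s)
    (hdense : ∀ u ∈ U, s * (k * #T) < #(H.coNeighbors U u)) :
    ∃ f Λ, #Λ ≤ k * #T ∧ IsForestEmbedding F H U l T Λ f := by
  classical
  obtain ⟨u₀, hu₀⟩ := hU
  induction T using Finset.strongInduction with
  | H T ih =>
    rcases T.eq_empty_or_nonempty with rfl | hTne
    · refine ⟨fun _ => u₀, ∅, by simp, by simp, by simp, by simp, ?_⟩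
      simpa using realizes_empty_right
    obtain ⟨y, hyT, hleaf⟩ := exists_neighborSet_inter_subsingleton
      fun hmin => hTne.ne_empty (hT T subset_rfl hmin)
    have hcard : k * #T = k * #(T.erase y) + k := by
      rw [← Finset.card_erase_add_one hyT, Nat.mul_succ]
    obtain ⟨f, Λ, hΛ, hf⟩ := ih (T.erase y) (Finset.erase_ssubset hyT)
      (fun Y hY => hT Y (hY.trans (T.erase_subset y)))
      (fun u hu => (Nat.mul_le_mul_left s (by omega)).trans_lt (hdense u hu))
    have hleaf' : (↑(T.erase y) ∩ F.neighborSet y).Subsingleton :=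
      hleaf.anti (Set.inter_subset_inter_left _ (Finset.coe_subset.mpr (T.erase_subset y)))
    obtain ⟨u, huU, hu⟩ : ∃ u ∈ U, ∀ x ∈ T.erase y, F.Adj y x → f x = u := by
      rcases hleaf'.eq_empty_or_singleton with hempty | ⟨x, hx⟩
      · exact ⟨u₀, hu₀, fun x hxT hyx => absurd (show x ∈ (∅ : Set W) from hempty ▸ ⟨hxT, hyx⟩) id⟩
      · have hxmem : x ∈ ↑(T.erase y) ∩ F.neighborSet y := hx ▸ rfl
        exact ⟨f x, hf.mapsTo x hxmem.1, fun x' hx' hyx' =>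
          congrArg f (hleaf' ⟨hx', hyx'⟩ hxmem)⟩
    obtain ⟨w, hw, hlw⟩ := exists_mem_label_notMem (Finset.filter_subset _ _) hl
      ((Nat.mul_le_mul_left s (by omega : #Λ ≤ k * #T)).trans_lt (hdense u huU))
    obtain ⟨hwU, d, hd, hud, hwd⟩ := UniformHypergraph.mem_coNeighbors.mp hw
    have hf' := hf.insert (T.notMem_erase y) hleaf' hd
      (fun x hxT hyx => hu x hxT hyx ▸ hud) hwd hwU hlw
    rw [Finset.insert_erase hyT] at hf'
    refine ⟨_, _, ?_, hf'⟩
    calc #(Λ ∪ d.image l) ≤ #Λ + #(d.image l) := Finset.card_union_le _ _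
      _ ≤ k * #(T.erase y) + k := Nat.add_le_add hΛ (Finset.card_image_le.trans (H.uniform d hd).le)
      _ = k * #T := hcard.symm

end Forests

/-! ### Petal systems -/

/-- The data of the hypergraph used for graphs with a nonempty `2`-core. Its vertices are core
vertices indexed by `α`, petals of `s` vertices each indexed by `π`, and `k - 2` private vertices
for every pair of core vertices; `V` may have further, isolated vertices. The hyperedges join each
petal to each kernel, a set of core vertices, and each pair of core vertices to its private
vertices. -/
structure PetalSystem (k s : ℕ) (α β π V : Type*) where
  kernel : β → Finset α
  kernel_injective : Function.Injective kernel
  card_kernel : ∀ i, #(kernel i) + s = k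
  two_le : 2 ≤ k
  vertex : α ⊕ (Sym2 α × Fin (k - 2)) ⊕ (π × Fin s) ↪ V

namespace PetalSystem

variable {k s : ℕ} {α β π V W : Type*} (P : PetalSystem k s α β π V) {i i' : β} {j j' : π}
  {a : α} {z z' : Sym2 α} {v : V}

/-- The core vertex of index `a`. -/
def core (a : α) : V := P.vertex (Sum.inl a)

/-- The private vertices of the pairs of core vertices. -/
def link (x : Sym2 α × Fin (k - 2)) : V := P.vertex (Sum.inr (Sum.inl x))

/-- The petal vertices; the first component of the argument is the index of the petal. -/
def petal (x : π × Fin s) : V := P.vertex (Sum.inr (Sum.inr x))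

/-- The hyperedge consisting of the kernel of index `i` and the petal of index `j`. -/
def petalEdge (i : β) (j : π) : Finset V :=
  ((P.kernel i).disjSum ((∅ : Finset (Sym2 α × Fin (k - 2))).disjSum
    (({j} : Finset π) ×ˢ Finset.univ))).map P.vertex

open Classical in
/-- The hyperedge consisting of the pair `z` of core vertices and its private vertices. -/
noncomputable def linkEdge (z : Sym2 α) : Finset V :=
  (z.toFinset.disjSum ((({z} : Finset (Sym2 α)) ×ˢ Finset.univ).disjSum
    (∅ : Finset (π × Fin s)))).map P.vertex

open Classical in
/-- The hypergraph of a petal system. -/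
noncomputable def hypergraph [Fintype α] [Fintype β] [Fintype π] : UniformHypergraph k V where
  edges := Finset.univ.image (fun x : β × π => P.petalEdge x.1 x.2) ∪
    ({z | ¬ z.IsDiag} : Finset (Sym2 α)).image P.linkEdge
  uniform := by
    intro d hd
    rcases Finset.mem_union.mp hd with hd | hd
    · obtain ⟨⟨i, j⟩, -, rfl⟩ := Finset.mem_image.mp hd
      simp [petalEdge, Finset.card_disjSum, P.card_kernel]
    · obtain ⟨z, hz, rfl⟩ := Finset.mem_image.mp hd
      have hz2 := Sym2.card_toFinset_of_not_isDiag z (Finset.mem_filter.mp hz).2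
      simp [linkEdge, Finset.card_disjSum, hz2, P.two_le]

/-- The index of the petal containing a vertex, and `none` outside the petals. -/
noncomputable def label : V → Option π :=
  Function.extend P.petal (some ∘ Prod.fst) fun _ => none

/-- The indices of the petals that `d` meets. -/
def petalLabels (d : Finset V) : Set π := {j | ∃ v ∈ d, P.label v = some j}

/-- The vertices in the petals. -/
def petalVertices [Fintype π] : Finset V :=
  Finset.univ.map ((Function.Embedding.inr.trans Function.Embedding.inr).trans P.vertex)

theorem core_injective : Function.Injective P.core :=
  P.vertex.injective.comp Sum.inl_injective

theorem petal_injective : Function.Injective P.petal :=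
  P.vertex.injective.comp (Sum.inr_injective.comp Sum.inr_injective)

@[simp] theorem core_mem_petalEdge : P.core a ∈ P.petalEdge i j ↔ a ∈ P.kernel i := by
  simp [core, petalEdge]

@[simp] theorem link_notMem_petalEdge {x : Sym2 α × Fin (k - 2)} :
    P.link x ∉ P.petalEdge i j := by
  simp [link, petalEdge]

@[simp] theorem petal_mem_petalEdge {x : π × Fin s} : P.petal x ∈ P.petalEdge i j ↔ x.1 = j := by
  simp [petal, petalEdge, Prod.ext_iff, eq_comm]

@[simp] theorem core_mem_linkEdge : P.core a ∈ P.linkEdge z ↔ a ∈ z := by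
  simp [core, linkEdge]

@[simp] theorem link_mem_linkEdge {x : Sym2 α × Fin (k - 2)} :
    P.link x ∈ P.linkEdge z ↔ x.1 = z := by
  simp [link, linkEdge, Prod.ext_iff, eq_comm]

@[simp] theorem petal_notMem_linkEdge {x : π × Fin s} : P.petal x ∉ P.linkEdge z := by
  simp [petal, linkEdge]

theorem petalEdge_left_injective (j : π) : Function.Injective fun i => P.petalEdge i j :=
  fun i i' h => P.kernel_injective <| Finset.ext fun a => by
    rw [← core_mem_petalEdge P (j := j), ← core_mem_petalEdge P (j := j)]
    exact iff_of_eq (congrArg (P.core a ∈ ·) h)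

theorem linkEdge_injective : Function.Injective P.linkEdge :=
  fun z z' h => Sym2.ext fun a => by rw [← core_mem_linkEdge P, h, core_mem_linkEdge]

theorem label_eq_some_iff : P.label v = some j ↔ ∃ x, P.petal (j, x) = v := by
  constructor
  · intro h
    by_cases hv : ∃ x, P.petal x = v
    · obtain ⟨⟨j', x⟩, rfl⟩ := hv
      rw [label, P.petal_injective.extend_apply] at h
      exact ⟨x, by rw [← Option.some.inj h]⟩
    · rw [label, Function.extend_apply' _ _ _ hv] at h
      exact (Option.some_ne_none j h.symm).elim
  · rintro ⟨x, rfl⟩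
    exact P.petal_injective.extend_apply ..

theorem label_core (a : α) : P.label (P.core a) = none :=
  Function.extend_apply' _ _ _ fun ⟨x, hx⟩ => by simp [petal, core] at hx

theorem mem_petalEdge_iff_of_label_eq_some (hv : P.label v = some j') :
    v ∈ P.petalEdge i j ↔ j' = j := by
  obtain ⟨x, rfl⟩ := P.label_eq_some_iff.mp hv
  exact petal_mem_petalEdge P

theorem notMem_linkEdge_of_label_eq_some (hv : P.label v = some j) : v ∉ P.linkEdge z := by
  obtain ⟨x, rfl⟩ := P.label_eq_some_iff.mp hv
  exact petal_notMem_linkEdge P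

theorem petalLabels_petalEdge (hs : 0 < s) : P.petalLabels (P.petalEdge i j) = {j} := by
  ext j'
  constructor
  · rintro ⟨v, hv, hl⟩
    exact (P.mem_petalEdge_iff_of_label_eq_some hl).mp hv
  · rintro rfl
    exact ⟨P.petal (j', ⟨0, hs⟩), by simp, P.label_eq_some_iff.mpr ⟨_, rfl⟩⟩

theorem petalLabels_linkEdge : P.petalLabels (P.linkEdge z) = ∅ :=
  Set.eq_empty_of_forall_notMem fun _ ⟨_, hv, hl⟩ => P.notMem_linkEdge_of_label_eq_some hl hv

theorem card_le_of_label_eq_some {Y : Finset V} (hY : ∀ v ∈ Y, P.label v = some j) : #Y ≤ s := by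
  classical
  have hsub : Y ⊆ Finset.univ.image fun x : Fin s => P.petal (j, x) := fun v hv => by
    obtain ⟨x, hx⟩ := P.label_eq_some_iff.mp (hY v hv)
    exact Finset.mem_image.mpr ⟨x, Finset.mem_univ x, hx⟩
  simpa using (Finset.card_le_card hsub).trans Finset.card_image_le

theorem card_petalVertices [Fintype π] : #P.petalVertices = Fintype.card π * s := by
  simp [petalVertices]

theorem exists_label_eq_some_of_mem_petalVertices [Fintype π]
    (hv : v ∈ P.petalVertices) :
    ∃ j, P.label v = some j := by
  obtain ⟨⟨j, x⟩, -, rfl⟩ := Finset.mem_map.mp hv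
  exact ⟨j, P.label_eq_some_iff.mpr ⟨x, rfl⟩⟩

section Hypergraph

variable [Fintype α] [Fintype β] [Fintype π]

theorem mem_edges_hypergraph {d : Finset V} :
    d ∈ P.hypergraph.edges ↔
      (∃ i j, P.petalEdge i j = d) ∨ ∃ z : Sym2 α, ¬ z.IsDiag ∧ P.linkEdge z = d := by
  simp [hypergraph]

theorem exists_eq_petalEdge {d : Finset V} (hd : d ∈ P.hypergraph.edges) (hv : v ∈ d)
    (hj : P.label v = some j) : ∃ i, d = P.petalEdge i j := by
  rcases P.mem_edges_hypergraph.mp hd with ⟨i, j', rfl⟩ | ⟨z, -, rfl⟩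
  · exact ⟨i, by rw [(P.mem_petalEdge_iff_of_label_eq_some hj).mp hv]⟩
  · exact (P.notMem_linkEdge_of_label_eq_some hj hv).elim

theorem exists_eq_core_or_label_eq_some {d d' : Finset V} (hd : d ∈ P.hypergraph.edges)
    (hd' : d' ∈ P.hypergraph.edges) (hne : d ≠ d') (hv : v ∈ d) (hv' : v ∈ d') :
    (∃ a, P.core a = v) ∨ ∃ j, P.label v = some j := by
  have hrange : ∃ x, P.vertex x = v := by
    rcases P.mem_edges_hypergraph.mp hd with ⟨i, j, rfl⟩ | ⟨z, -, rfl⟩ <;>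
      exact (Finset.mem_map.mp hv).imp fun _ => And.right
  have hlink : ∀ x, P.link x = v → ∀ d ∈ P.hypergraph.edges, v ∈ d → d = P.linkEdge x.1 := by
    rintro x rfl d hd hx
    rcases P.mem_edges_hypergraph.mp hd with ⟨i, j, rfl⟩ | ⟨z, -, rfl⟩
    · exact (link_notMem_petalEdge P hx).elim
    · rw [(link_mem_linkEdge P).mp hx]
  obtain ⟨a | x | ⟨j, x⟩, hx⟩ := hrange
  · exact Or.inl ⟨a, hx⟩
  · exact (hne ((hlink x hx d hd hv).trans (hlink x hx d' hd' hv').symm)).elim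
  · exact Or.inr ⟨j, P.label_eq_some_iff.mpr ⟨x, hx⟩⟩

end Hypergraph

end PetalSystem

/-! ### Extensions of petal systems contain `F` -/

/-- Any `d` elements, or fewer, of `α` lie in distinct members of the family `S`. -/
def HasTransversals {α β : Type*} (d : ℕ) (S : β → Finset α) : Prop :=
  ∀ Q : Finset α, #Q ≤ d → ∃ σ : α → β, Set.InjOn σ Q ∧ ∀ a ∈ Q, a ∈ S (σ a)

theorem injOn_sym2Map {W α : Type*} {c : W → α} {A : Finset W} (hc : Set.InjOn c A) :
    Set.InjOn (Sym2.map c) A.sym2 := by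
  intro e he e' he' heq
  induction e with | _ a b
  induction e' with | _ a' b'
  obtain ⟨ha, hb⟩ := Finset.mk_mem_sym2_iff.mp he
  obtain ⟨ha', hb'⟩ := Finset.mk_mem_sym2_iff.mp he'
  rw [Sym2.map_mk, Sym2.map_mk, Sym2.eq_iff] at heq
  rw [Sym2.eq_iff]
  exact heq.imp (fun h => ⟨hc ha ha' h.1, hc hb hb' h.2⟩) fun h => ⟨hc ha hb' h.1, hc hb ha' h.2⟩

theorem edgeSet_subset_core_union_mixed_union_forest {W : Type*} [Fintype W] [DecidableEq W]
    (F : SimpleGraph W) (A : Finset W) :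
    F.edgeSet ⊆ (F.edgeSet ∩ A.sym2 ∪ {e | ∃ v ∉ A, ∃ a ∈ A, F.Adj v a ∧ e = s(v, a)}) ∪
      F.edgeSet ∩ Aᶜ.sym2 := by
  intro e he
  induction e with | _ v w
  have hvw : F.Adj v w := he
  by_cases hv : v ∈ A <;> by_cases hw : w ∈ A
  · exact Or.inl (Or.inl ⟨he, Finset.mk_mem_sym2_iff.mpr ⟨hv, hw⟩⟩)
  · exact Or.inl (Or.inr ⟨w, hw, v, hv, hvw.symm, Sym2.eq_swap⟩)
  · exact Or.inl (Or.inr ⟨v, hv, w, hw, hvw, rfl⟩)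
  · exact Or.inr ⟨he, Finset.mk_mem_sym2_iff.mpr (by simp [hv, hw])⟩

namespace PetalSystem

variable {k s d : ℕ} {α β π V W : Type*}
  (P : PetalSystem k s α β π V) {F : SimpleGraph W} {H : UniformHypergraph k V} {A : Finset W}
  {f : W → V}

theorem realizes_forest_edges {T : Finset W} {j : W → π}
    (hf : Realizes H.edges (F.edgeSet ∩ T.sym2) f)
    (hj : ∀ w ∈ T, P.label (f w) = some (j w)) (hinj : Set.InjOn j T) :
    Realizes {d | d ∈ H.edges ∧ (P.petalLabels d).Nontrivial} (F.edgeSet ∩ T.sym2) f := by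
  refine hf.mono_left_of_forall fun d hd e he hed => ⟨hd, ?_⟩
  induction e with | _ v w
  obtain ⟨hvw, hT⟩ := he
  obtain ⟨hv, hw⟩ := Finset.mk_mem_sym2_iff.mp hT
  exact ⟨j v, ⟨f v, hed v (Sym2.mem_mk_left v w), hj v hv⟩, j w,
    ⟨f w, hed w (Sym2.mem_mk_right v w), hj w hw⟩, hinj.ne hv hw (F.ne_of_adj hvw)⟩

variable [Fintype α] [Fintype β] [Fintype π]

theorem realizes_core_edges (hPH : P.hypergraph.IsSubhypergraph H) {c : W → α}
    (hc : Set.InjOn c A) (hf : ∀ w ∈ A, f w = P.core (c w)) :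
    Realizes {d | d ∈ H.edges ∧ P.petalLabels d = ∅} (F.edgeSet ∩ A.sym2) f := by
  have hinj : Set.InjOn (P.linkEdge ∘ Sym2.map c) (F.edgeSet ∩ A.sym2) :=
    P.linkEdge_injective.comp_injOn ((injOn_sym2Map hc).mono Set.inter_subset_right)
  have hmem : ∀ e ∈ F.edgeSet ∩ A.sym2, ∀ w ∈ e, f w ∈ P.linkEdge (e.map c) := by
    rintro e ⟨-, heA⟩ w hw
    rw [hf w (Finset.mem_sym2_iff.mp heA w hw), core_mem_linkEdge]
    exact Sym2.mem_map.mpr ⟨w, hw, rfl⟩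
  refine (realizes_image (φ := id) hinj hmem).mono ?_ (Set.image_id _).superset
  rintro _ ⟨e, ⟨he, heA⟩, rfl⟩
  refine ⟨hPH (P.mem_edges_hypergraph.mpr (Or.inr ⟨e.map c, ?_, rfl⟩)), P.petalLabels_linkEdge⟩
  induction e with | _ a b
  obtain ⟨ha, hb⟩ := Finset.mk_mem_sym2_iff.mp heA
  simpa using fun h => F.ne_of_adj he (hc ha hb h)

theorem realizes_mixed_edges (hPH : P.hypergraph.IsSubhypergraph H) {c : W → α}
    (hc : Set.InjOn c A) (hf : ∀ w ∈ A, f w = P.core (c w))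
    {j : W → π} (hj : ∀ w ∉ A, P.label (f w) = some (j w)) (hinj : Set.InjOn j (↑A)ᶜ)
    (hd : ∀ v ∉ A, ∀ Q ⊆ A, (∀ a ∈ Q, F.Adj v a) → #Q ≤ d) (hS : HasTransversals d P.kernel) :
    Realizes {d | d ∈ H.edges ∧ ∃ j, P.petalLabels d = {j}}
      {e | ∃ v ∉ A, ∃ a ∈ A, F.Adj v a ∧ e = s(v, a)} f := by
  classical
  have htrans : ∀ v ∉ A, ∃ σ : W → β, Set.InjOn σ {a | a ∈ A ∧ F.Adj v a} ∧
      ∀ a ∈ A, F.Adj v a → c a ∈ P.kernel (σ a) := by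
    intro v hv
    have hmem : ∀ a ∈ A, F.Adj v a → c a ∈ {a ∈ A | F.Adj v a}.image c := fun a ha hva =>
      Finset.mem_image_of_mem c (Finset.mem_filter.mpr ⟨ha, hva⟩)
    obtain ⟨σ, hσ, hσS⟩ := hS ({a ∈ A | F.Adj v a}.image c) (Finset.card_image_le.trans
      (hd v hv _ (Finset.filter_subset _ _) fun a ha => (Finset.mem_filter.mp ha).2))
    exact ⟨σ ∘ c, fun a ha b hb h => hc ha.1 hb.1 (hσ (hmem a ha.1 ha.2) (hmem b hb.1 hb.2) h),
      fun a ha hva => hσS _ (hmem a ha hva)⟩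
  rcases isEmpty_or_nonempty β with hβ | hβ
  · exact realizes_empty_right.mono subset_rfl fun e ⟨v, hv, a, _⟩ =>
      (htrans v hv).elim fun σ _ => hβ.elim (σ a)
  choose! σ hσ hσS using htrans
  set I : Set (W × W) := {p | p.1 ∉ A ∧ p.2 ∈ A ∧ F.Adj p.1 p.2}
  have hinjI : I.InjOn fun p => P.petalEdge (σ p.1 p.2) (j p.1) := by
    rintro ⟨v, a⟩ ⟨hv, ha, hva⟩ ⟨v', a'⟩ ⟨hv', ha', hva'⟩ heq
    have hfv : f v ∈ P.petalEdge (σ v' a') (j v') :=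
      heq.subset ((P.mem_petalEdge_iff_of_label_eq_some (hj v hv)).mpr rfl)
    have hjj : j v = j v' := (P.mem_petalEdge_iff_of_label_eq_some (hj v hv)).mp hfv
    obtain rfl : v = v' := hinj hv hv' hjj
    exact Prod.ext rfl (hσ v hv ⟨ha, hva⟩ ⟨ha', hva'⟩ (P.petalEdge_left_injective (j v) heq))
  have hmem : ∀ p ∈ I, ∀ w ∈ s(p.1, p.2), f w ∈ P.petalEdge (σ p.1 p.2) (j p.1) := by
    rintro ⟨v, a⟩ ⟨hv, ha, hva⟩ w hw
    rcases Sym2.mem_iff.mp hw with rfl | rfl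
    · exact (P.mem_petalEdge_iff_of_label_eq_some (hj w hv)).mpr rfl
    · exact hf w ha ▸ (core_mem_petalEdge P).mpr (hσS v hv w ha hva)
  refine (realizes_image hinjI hmem).mono ?_ ?_
  · rintro _ ⟨⟨v, a⟩, ⟨hv, -, -⟩, rfl⟩
    obtain ⟨x, -⟩ := P.label_eq_some_iff.mp (hj v hv)
    exact ⟨hPH (P.mem_edges_hypergraph.mpr (Or.inl ⟨_, _, rfl⟩)), j v,
      P.petalLabels_petalEdge x.pos⟩
  · rintro _ ⟨v, hv, a, ha, hva, rfl⟩
    exact ⟨(v, a), ⟨hv, ha, hva⟩, rfl⟩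

/-- The edges of `F` inside `A`, between `A` and its complement, and inside the complement use
hyperedges meeting no petal, one petal, and at least two petals, respectively. -/
theorem containsBerge_of_realizes_forest_edges [Fintype W] [DecidableEq W]
    (hPH : P.hypergraph.IsSubhypergraph H) {c : W → α} (hc : Set.InjOn c A)
    (hf : ∀ w ∈ A, f w = P.core (c w)) {j : W → π} (hj : ∀ w ∉ A, P.label (f w) = some (j w))
    (hinj : Set.InjOn j (↑A)ᶜ) (hd : ∀ v ∉ A, ∀ Q ⊆ A, (∀ a ∈ Q, F.Adj v a) → #Q ≤ d)
    (hS : HasTransversals d P.kernel) (hforest : Realizes H.edges (F.edgeSet ∩ Aᶜ.sym2) f) :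
    H.ContainsBerge F := by
  have hfinj : Function.Injective f := by
    intro v w hvw
    by_cases hv : v ∈ A <;> by_cases hw : w ∈ A
    · exact hc hv hw (P.core_injective (by rw [← hf v hv, ← hf w hw, hvw]))
    · have := hj w hw
      rw [← hvw, hf v hv, P.label_core] at this
      exact (Option.some_ne_none _ this.symm).elim
    · have := hj v hv
      rw [hvw, hf w hw, P.label_core] at this
      exact (Option.some_ne_none _ this.symm).elim
    · exact hinj hv hw (Option.some_injective π (by rw [← hj v hv, ← hj w hw, hvw]))
  have hcore := P.realizes_core_edges (F := F) hPH hc hf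
  have hmixed := P.realizes_mixed_edges (F := F) hPH hc hf hj hinj hd hS
  have hforest' := P.realizes_forest_edges hforest (fun w hw => hj w (Finset.mem_compl.mp hw))
    (by rwa [Finset.coe_compl])
  refine UniformHypergraph.containsBerge_iff_realizes.mpr ⟨⟨f, hfinj⟩,
    ((hcore.union hmixed ?_).union hforest' ?_).mono ?_
      (edgeSet_subset_core_union_mixed_union_forest F A)⟩
  · rw [Set.disjoint_left]
    rintro _ ⟨-, h⟩ ⟨-, j, h'⟩
    exact Set.singleton_ne_empty j (h'.symm.trans h)
  · rw [Set.disjoint_left]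
    rintro _ (⟨-, h⟩ | ⟨-, j, h⟩) ⟨-, h'⟩
    · exact h'.ne_empty h
    · exact h'.ne_singleton h
  · rintro _ ((h | h) | h) <;> exact h.1

theorem containsBerge_of_isSubhypergraph [Nonempty α] [Fintype W]
    (hPH : P.hypergraph.IsSubhypergraph H) (hA : IsFeedbackVertexSet F A)
    (hAα : #A ≤ Fintype.card α) (hd : ∀ v ∉ A, ∀ Q ⊆ A, (∀ a ∈ Q, F.Adj v a) → #Q ≤ d)
    (hS : HasTransversals d P.kernel) {U : Finset V} (hUP : U ⊆ P.petalVertices)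
    (hU : U.Nonempty) (hdense : ∀ u ∈ U, s * (k * Fintype.card W) < #(H.coNeighbors U u)) :
    H.ContainsBerge F := by
  classical
  obtain ⟨c, -, hc⟩ : ∃ c : W → α, (A : Set W) ⊆ c ⁻¹' Set.univ ∧ Set.InjOn c A :=
    A.finite_toSet.exists_injOn_of_encard_le (by simpa using hAα)
  have hlabel : ∀ u ∈ U, ∃ j, P.label u = some j := fun u hu =>
    P.exists_label_eq_some_of_mem_petalVertices (hUP hu)
  have hclass : ∀ l, #{v ∈ U | P.label v = l} ≤ s := by
    rintro (- | j)
    · have hempty : {v ∈ U | P.label v = none} = ∅ := Finset.filter_eq_empty_iff.mpr fun u hu h =>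
        (hlabel u hu).elim fun j hj => Option.some_ne_none j (hj.symm.trans h)
      exact hempty ▸ Nat.zero_le s
    · exact P.card_le_of_label_eq_some fun v hv => (Finset.mem_filter.mp hv).2
  obtain ⟨g, Λ, -, hg⟩ := exists_isForestEmbedding (T := Aᶜ)
    (fun Y hY hmin => hA Y hmin (Finset.subset_compl_iff_disjoint_right.mp hY)) hU hclass
    (fun u hu => (Nat.mul_le_mul_left s (Nat.mul_le_mul_left k (Finset.card_le_univ _))).trans_lt
      (hdense u hu))
  have : Nonempty π := ⟨(hlabel _ hU.choose_spec).choose⟩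
  choose! j hj using hlabel
  have hgj : ∀ w ∉ A, P.label (g w) = some (j (g w)) := fun w hw =>
    hj _ (hg.mapsTo w (Finset.mem_compl.mpr hw))
  set f : W → V := A.piecewise (P.core ∘ c) g
  have hfg : ∀ w ∉ A, g w = f w := fun w hw => (Finset.piecewise_eq_of_notMem _ _ _ hw).symm
  refine P.containsBerge_of_realizes_forest_edges (j := j ∘ g) hPH hc
    (fun w hw => Finset.piecewise_eq_of_mem A (P.core ∘ c) g hw)
    (fun w hw => (congrArg P.label (hfg w hw)).symm.trans (hgj w hw)) (fun v hv w hw hvw => ?_) hd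
    hS ((hg.realizes.mono (fun d hd => hd.1) subset_rfl).congr fun e he w hw =>
      hfg w (Finset.mem_compl.mp (Finset.mem_sym2_iff.mp he.2 w hw)))
  exact hg.injOn (by simpa using hv) (by simpa using hw)
    ((hgj v hv).trans ((congrArg some hvw).trans (hgj w hw).symm))

end PetalSystem

/-! ### Decompositions of graphs contained in petal systems -/

/-- The structure which a Berge-`F` in a petal system of petal size `s` forces on `F[K]`, where
`F[K]` has minimum degree two: `core` consists of the vertices embedded as core vertices, and
`classes` relates the vertices embedded in the same petal. The numbers of core vertices and of
kernels of the petal system are `t` and `q`. -/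
structure PetalDecomposition {W : Type*} (F : SimpleGraph W) (K : Finset W) (t s q : ℕ) where
  core : Finset W
  core_subset : core ⊆ K
  card_core_le : #core ≤ t
  classes : Setoid W
  rel_of_adj : ∀ {u v}, u ∈ K → v ∈ K → u ∉ core → v ∉ core → F.Adj u v → classes u v
  card_vertices_le : ∀ v, ∀ Y : Finset W, (∀ y ∈ Y, y ∈ K ∧ y ∉ core ∧ classes y v) → #Y ≤ s
  card_edges_le : ∀ v, ∀ E : Finset (Sym2 W), (∀ e ∈ E, ∃ x y, e = s(x, y) ∧ F.Adj x y ∧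
    x ∈ K ∧ y ∈ K ∧ x ∉ core ∧ classes x v) → #E ≤ q

namespace PetalSystem

variable {k s : ℕ} {α β π V W : Type*} [Fintype α] [Fintype β] [Fintype π]
  (P : PetalSystem k s α β π V) {F : SimpleGraph W} {K : Finset W}

theorem exists_core_eq_or_label_eq_some_of_realizes {f : W → V}
    (hf : Realizes P.hypergraph.edges F.edgeSet f) (hK : InducesMinDegTwo F K) {w : W}
    (hw : w ∈ K) : (∃ a, P.core a = f w) ∨ ∃ j, P.label (f w) = some j := by
  obtain ⟨g, hg, hmem⟩ := hf
  obtain ⟨a, ⟨-, ha⟩, b, ⟨-, hb⟩, hab⟩ := hK w hw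
  have hedge : ∀ {x}, F.Adj w x → g s(w, x) ∈ P.hypergraph.edges ∧ f w ∈ g s(w, x) := fun hx =>
    (hmem _ hx).imp id fun h => h w (Sym2.mem_mk_left _ _)
  exact P.exists_eq_core_or_label_eq_some (hedge ha).1 (hedge hb).1
    (hg.ne ha hb fun h => hab (Sym2.congr_right.mp h)) (hedge ha).2 (hedge hb).2

theorem eq_of_mem_edges_of_label_eq_some {d : Finset V} (hd : d ∈ P.hypergraph.edges) {u v : V}
    (hu : u ∈ d) (hv : v ∈ d) {j j' : π} (hj : P.label u = some j) (hj' : P.label v = some j') :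
    j = j' := by
  obtain ⟨i, rfl⟩ := P.exists_eq_petalEdge hd hu hj
  exact ((P.mem_petalEdge_iff_of_label_eq_some hj').mp hv).symm

omit [Fintype α] [Fintype π] in
theorem card_le_of_forall_eq_petalEdge {D : Finset (Finset V)} {j : π}
    (hD : ∀ d ∈ D, ∃ i, d = P.petalEdge i j) : #D ≤ Fintype.card β := by
  classical
  have hsub : D ⊆ Finset.univ.image fun i => P.petalEdge i j := fun d hd =>
    (hD d hd).elim fun i hi => Finset.mem_image.mpr ⟨i, Finset.mem_univ i, hi.symm⟩
  exact (Finset.card_le_card hsub).trans Finset.card_image_le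

theorem nonempty_petalDecomposition (hPF : P.hypergraph.ContainsBerge F)
    (hK : InducesMinDegTwo F K) :
    Nonempty (PetalDecomposition F K (Fintype.card α) s (Fintype.card β)) := by
  classical
  obtain ⟨f, hf⟩ := UniformHypergraph.containsBerge_iff_realizes.mp hPF
  set core : Finset W := {w ∈ K | ∃ a, P.core a = f w}
  have hlabel : ∀ {w}, w ∈ K → w ∉ core → ∃ j, P.label (f w) = some j := fun hw hwc =>
    (P.exists_core_eq_or_label_eq_some_of_realizes hf hK hw).resolve_left fun h =>
      hwc (Finset.mem_filter.mpr ⟨hw, h⟩)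
  obtain ⟨g, hg, hmem⟩ := hf
  refine ⟨⟨core, Finset.filter_subset _ _, ?_, Setoid.ker (P.label ∘ f), ?_, ?_, ?_⟩⟩
  · calc #core = #(core.map f) := (Finset.card_map f).symm
      _ ≤ #(Finset.univ.image P.core) := Finset.card_le_card fun v hv => by
          obtain ⟨w, hw, rfl⟩ := Finset.mem_map.mp hv
          simpa using (Finset.mem_filter.mp hw).2
      _ ≤ Fintype.card α := Finset.card_image_le
  · intro u v hu hv huc hvc huv
    obtain ⟨j, hj⟩ := hlabel hu huc
    obtain ⟨j', hj'⟩ := hlabel hv hvc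
    have hjj' : j = j' := P.eq_of_mem_edges_of_label_eq_some (hmem _ huv).1
      ((hmem _ huv).2 u (Sym2.mem_mk_left u v)) ((hmem _ huv).2 v (Sym2.mem_mk_right u v)) hj hj'
    exact hj.trans ((congrArg some hjj').trans hj'.symm)
  · intro v Y hY
    rcases Y.eq_empty_or_nonempty with rfl | ⟨y, hy⟩
    · exact Nat.zero_le s
    obtain ⟨j, hj⟩ := hlabel (hY y hy).1 (hY y hy).2.1
    rw [← Finset.card_map f]
    refine P.card_le_of_label_eq_some (j := j) fun u hu => ?_
    obtain ⟨w, hw, rfl⟩ := Finset.mem_map.mp hu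
    exact (hY w hw).2.2.trans ((hY y hy).2.2.symm.trans hj)
  · intro v E hE
    rcases E.eq_empty_or_nonempty with rfl | ⟨e, he⟩
    · exact Nat.zero_le _
    obtain ⟨x, -, -, -, hx, -, hxc, hxv⟩ := hE e he
    obtain ⟨j, hj⟩ := hlabel hx hxc
    have hEF : Set.InjOn g E := hg.mono fun e' he' => by
      obtain ⟨x', y', rfl, hxy', -⟩ := hE e' he'
      exact hxy'
    rw [← Finset.card_image_of_injOn hEF]
    refine P.card_le_of_forall_eq_petalEdge (j := j) fun d hd => ?_
    obtain ⟨e', he', rfl⟩ := Finset.mem_image.mp hd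
    obtain ⟨x', y', rfl, hxy', -, -, -, hxv'⟩ := hE e' he'
    exact P.exists_eq_petalEdge (hmem _ hxy').1 ((hmem _ hxy').2 x' (Sym2.mem_mk_left x' y'))
      (hxv'.trans (hxv.symm.trans hj))

end PetalSystem

/-! ### Linear saturation from dense extensions -/

/-- For all large `n` there is a Berge-`F`-saturated `k`-uniform hypergraph on `n` vertices with at
most `C * n` hyperedges, where `C` does not depend on `n`. -/
def HasLinearSaturation {W : Type*} (k : ℕ) (F : SimpleGraph W) : Prop :=
  ∃ C : ℕ, ∀ᶠ n in atTop, ∃ H : UniformHypergraph k (Fin n),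
    H.IsBergeSaturated F ∧ #H.edges ≤ C * n

theorem hasLinearSaturation_of_dense_containsBerge {W : Type*} {k x M : ℕ} {F : SimpleGraph W}
    (h : ∀ᶠ n in atTop, ∃ (H₀ : UniformHypergraph k (Fin n)) (Y : Finset (Fin n)),
      ¬ H₀.ContainsBerge F ∧ #Yᶜ ≤ x ∧ ∀ H : UniformHypergraph k (Fin n), H₀.IsSubhypergraph H →
        ∀ U ⊆ Y, U.Nonempty → (∀ u ∈ U, M < #(H.coNeighbors U u)) → H.ContainsBerge F) :
    HasLinearSaturation k F := by
  refine ⟨2 ^ (x + M) * 2, ?_⟩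
  filter_upwards [h, eventually_ge_atTop 1] with n ⟨H₀, Y, hfree, hY, hdense⟩ hn
  obtain ⟨H, hH₀H, hH⟩ := UniformHypergraph.exists_isBergeSaturated_of_not_containsBerge hfree
  have hYn : #Y + 1 ≤ 2 * n := by
    have := Y.card_le_univ
    rw [Fintype.card_fin] at this
    lia
  refine ⟨H, hH, ?_⟩
  calc #H.edges ≤ 2 ^ (#Yᶜ + M) * (#Y + 1) := by
        by_contra! hcard
        obtain ⟨U, hUY, hU, hUM⟩ := H.exists_forall_lt_card_coNeighbors hcard
        exact hH.1 (hdense H hH₀H U hUY hU hUM)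
    _ ≤ 2 ^ (x + M) * (2 * n) := by gcongr; norm_num
    _ = 2 ^ (x + M) * 2 * n := (mul_assoc _ _ _).symm

theorem hasLinearSaturation_of_isEmpty_petalDecomposition {W α β : Type*} [Finite W] [Fintype α]
    [Nonempty α] [Fintype β] {k s d : ℕ} {F : SimpleGraph W} {A K : Finset W}
    {kernel : β → Finset α} (hk : 2 ≤ k) (hs : 0 < s) (hinj : Function.Injective kernel)
    (hcard : ∀ i, #(kernel i) + s = k) (hkernel : HasTransversals d kernel)
    (hA : IsFeedbackVertexSet F A) (hAα : #A ≤ Fintype.card α)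
    (hd : ∀ v ∉ A, ∀ Q ⊆ A, (∀ a ∈ Q, F.Adj v a) → #Q ≤ d) (hK : InducesMinDegTwo F K)
    (hdecomp : IsEmpty (PetalDecomposition F K (Fintype.card α) s (Fintype.card β))) :
    HasLinearSaturation k F := by
  have := Fintype.ofFinite W
  set b := Fintype.card α + Fintype.card (Sym2 α) * (k - 2)
  refine hasLinearSaturation_of_dense_containsBerge (x := b + s) (M := s * (k * Fintype.card W)) ?_
  filter_upwards [eventually_ge_atTop b] with n hn
  have hmod := Nat.mod_lt (n - b) hs
  have hdiv := Nat.div_add_mod' (n - b) s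
  obtain ⟨vertex⟩ : Nonempty
      (α ⊕ (Sym2 α × Fin (k - 2)) ⊕ (Fin ((n - b) / s) × Fin s) ↪ Fin n) := by
    refine Function.Embedding.nonempty_of_card_le ?_
    simp only [Fintype.card_sum, Fintype.card_prod, Fintype.card_fin]
    lia
  let P : PetalSystem k s α β (Fin ((n - b) / s)) (Fin n) := ⟨kernel, hinj, hcard, hk, vertex⟩
  refine ⟨P.hypergraph, P.petalVertices,
    fun hPF => hdecomp.elim (P.nonempty_petalDecomposition hPF hK).some, ?_,
    fun H hPH U hUP hU hUM => P.containsBerge_of_isSubhypergraph hPH hA hAα hd hkernel hUP hU hUM⟩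
  rw [Finset.card_compl, P.card_petalVertices, Fintype.card_fin, Fintype.card_fin]
  lia

theorem hasLinearSaturation_of_isFeedbackVertexSet_empty {W : Type*} [Finite W] {k : ℕ}
    {F : SimpleGraph W} (hF : F ≠ ⊥) (hforest : IsFeedbackVertexSet F ∅) :
    HasLinearSaturation k F := by
  classical
  have := Fintype.ofFinite W
  refine hasLinearSaturation_of_dense_containsBerge (x := 0) (M := 1 * (k * Fintype.card W))
    (Eventually.of_forall fun n => ⟨⟨∅, by simp⟩, Finset.univ,
      UniformHypergraph.not_containsBerge_of_edges_eq_empty hF rfl, by simp,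
      fun H _ U _ hU hUM => ?_⟩)
  obtain ⟨f, Λ, -, hf⟩ := exists_isForestEmbedding (T := (Finset.univ : Finset W)) (l := id)
    (fun Y _ hY => hforest Y hY (Finset.disjoint_empty_right Y)) hU
    (fun c => (Finset.card_le_one.mpr (by simp +contextual) : #{v ∈ U | id v = c} ≤ 1)) hUM
  refine UniformHypergraph.containsBerge_iff_realizes.mpr
    ⟨⟨f, fun v w hvw => hf.injOn (by simp) (by simp) hvw⟩, hf.realizes.mono (fun d hd => hd.1) ?_⟩
  simp

/-! ### Feedback vertex sets and vertex covers of the `2`-core -/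

/-- `C` is a vertex cover of the subgraph of `F` induced on `K`. Unlike in `F.induce K`, the
vertices of `C` need not lie in `K`. -/
def IsVertexCoverOn {W : Type*} (F : SimpleGraph W) (K C : Finset W) : Prop :=
  ∀ u ∈ K, ∀ v ∈ K, F.Adj u v → u ∈ C ∨ v ∈ C

/-- The subgraph of `F` induced on `R` has maximum degree at most one, that is, its edges form a
matching. -/
def InducesMaxDegOne {W : Type*} (F : SimpleGraph W) (R : Finset W) : Prop :=
  ∀ u ∈ R, (↑R ∩ F.neighborSet u).Subsingleton

/-- `T` is the vertex set of a component of the subgraph of `F` induced on `K`, and `T` spans a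
triangle. -/
structure IsTriangleComponent {W : Type*} (F : SimpleGraph W) (K T : Finset W) : Prop where
  subset : T ⊆ K
  isNClique : F.IsNClique 3 T
  mem_of_adj : ∀ {x y}, x ∈ T → y ∈ K → F.Adj x y → y ∈ T

section

variable {W : Type*} {F : SimpleGraph W} {A B C K T Y : Finset W} {a u v : W} {s t q : ℕ}

theorem InducesMinDegTwo.exists_adj_ne (hK : InducesMinDegTwo F K) (hu : u ∈ K) (v : W) :
    ∃ x ∈ K, x ≠ v ∧ F.Adj u x := by
  obtain ⟨x, ⟨hxK, hux⟩, hxv⟩ := (hK u hu).exists_ne v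
  exact ⟨x, hxK, hxv, hux⟩

protected theorem InducesMinDegTwo.insert [DecidableEq W] (hK : InducesMinDegTwo F K)
    (hv : (↑K ∩ F.neighborSet v).Nontrivial) : InducesMinDegTwo F (insert v K) := by
  have hmono : ∀ y, (↑K ∩ F.neighborSet y : Set W) ⊆ ↑(insert v K) ∩ F.neighborSet y := fun y =>
    Set.inter_subset_inter_left _ (Finset.coe_subset.mpr (Finset.subset_insert v K))
  intro y hy
  rcases Finset.mem_insert.mp hy with rfl | hy
  · exact hv.mono (hmono y)
  · exact (hK y hy).mono (hmono y)

theorem inducesMinDegTwo_of_isClique (hT : F.IsClique T) (hT3 : 3 ≤ #T) :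
    InducesMinDegTwo F T := by
  classical
  intro y hy
  have hcard : 1 < #(T.erase y) := by rw [Finset.card_erase_of_mem hy]; lia
  refine (Finset.one_lt_card_iff_nontrivial.mp hcard).mono fun x hx => ?_
  obtain ⟨hxy, hxT⟩ := Finset.mem_erase.mp hx
  exact ⟨hxT, hT hy hxT hxy.symm⟩

theorem exists_isGreatest_inducesMinDegTwo [Finite W] (F : SimpleGraph W) :
    ∃ K, IsGreatest {Y | InducesMinDegTwo F Y} K := by
  classical
  have := Fintype.ofFinite W
  have hsub : ∀ Y, InducesMinDegTwo F Y →
      Y ⊆ ({v | ∃ Y, InducesMinDegTwo F Y ∧ v ∈ Y} : Finset W) := fun Y hY y hy =>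
    Finset.mem_filter.mpr ⟨Finset.mem_univ y, Y, hY, hy⟩
  refine ⟨_, fun y hy => ?_, hsub⟩
  obtain ⟨-, Y, hY, hyY⟩ := Finset.mem_filter.mp hy
  exact (hY y hyY).mono (Set.inter_subset_inter_left _ (Finset.coe_subset.mpr (hsub Y hY)))

theorem card_le_one_of_forall_adj_of_notMem (hK : IsGreatest {Y | InducesMinDegTwo F Y} K)
    (hv : v ∉ K) (hAK : A ⊆ K) (hvA : ∀ a ∈ A, F.Adj v a) : #A ≤ 1 := by
  classical
  by_contra! hA
  have hnontrivial : (↑K ∩ F.neighborSet v).Nontrivial :=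
    (Finset.one_lt_card_iff_nontrivial.mp hA).mono fun a ha => ⟨hAK ha, hvA a ha⟩
  exact hv (hK.2 (InducesMinDegTwo.insert hK.1 hnontrivial) (Finset.mem_insert_self v K))

theorem IsFeedbackVertexSet.inter [DecidableEq W] (hA : IsFeedbackVertexSet F A)
    (hK : K ∈ upperBounds {Y | InducesMinDegTwo F Y}) : IsFeedbackVertexSet F (A ∩ K) :=
  fun Y hY hYA => hA Y hY <| Finset.disjoint_left.mpr fun _ hyY hyA =>
    Finset.disjoint_left.mp hYA hyY (Finset.mem_inter.mpr ⟨hyA, hK hY hyY⟩)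

theorem isFeedbackVertexSet_of_inducesMaxDegOne [DecidableEq W]
    (hK : K ∈ upperBounds {Y | InducesMinDegTwo F Y}) (hB : InducesMaxDegOne F (K \ B)) :
    IsFeedbackVertexSet F B := by
  intro Y hY hYB
  have hYK : Y ⊆ K \ B := fun y hy =>
    Finset.mem_sdiff.mpr ⟨hK hY hy, Finset.disjoint_left.mp hYB hy⟩
  refine Finset.eq_empty_of_forall_notMem fun y hy => (hY y hy).not_subsingleton ?_
  exact (hB y (hYK hy)).anti (Set.inter_subset_inter_left _ (Finset.coe_subset.mpr hYK))

theorem IsVertexCoverOn.mono (hC : IsVertexCoverOn F K C) (hY : Y ⊆ K) : IsVertexCoverOn F Y C :=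
  fun u hu v hv => hC u (hY hu) v (hY hv)

theorem IsVertexCoverOn.card_le_card_inter_add_one [DecidableEq W] (hC : IsVertexCoverOn F K C)
    (hTK : T ⊆ K) (hT : F.IsClique T) : #T ≤ #(T ∩ C) + 1 := by
  have hdiff : #(T \ C) ≤ 1 := Finset.card_le_one.mpr fun x hx y hy => by
    obtain ⟨hxT, hxC⟩ := Finset.mem_sdiff.mp hx
    obtain ⟨hyT, hyC⟩ := Finset.mem_sdiff.mp hy
    by_contra hxy
    exact (hC x (hTK hxT) y (hTK hyT) (hT hxT hyT hxy)).elim hxC hyC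
  have := Finset.card_inter_add_card_sdiff T C
  lia

theorem IsVertexCoverOn.eq_empty_of_disjoint_erase [DecidableEq W] (hC : IsVertexCoverOn F Y C)
    (hY : InducesMinDegTwo F Y) {x : W} (hYC : Disjoint Y (C.erase x)) : Y = ∅ := by
  have heq : ∀ y ∈ Y, y ∈ C → y = x := fun y hy hyC => by
    by_contra hyx
    exact Finset.disjoint_left.mp hYC hy (Finset.mem_erase.mpr ⟨hyx, hyC⟩)
  have hYx : ∀ y ∈ Y, y = x := by
    intro y hy
    obtain ⟨z, hz, hzx, hyz⟩ := hY.exists_adj_ne hy x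
    exact heq y hy ((hC y hy z hz hyz).resolve_right fun hzC => hzx (heq z hz hzC))
  refine Finset.eq_empty_of_forall_notMem fun y hy => ?_
  obtain ⟨z, hz, hzx, -⟩ := hY.exists_adj_ne hy x
  exact hzx (hYx z hz)

theorem IsVertexCoverOn.isFeedbackVertexSet_erase [DecidableEq W] (hC : IsVertexCoverOn F K C)
    (hK : K ∈ upperBounds {Y | InducesMinDegTwo F Y}) (x : W) :
    IsFeedbackVertexSet F (C.erase x) :=
  fun _ hY => (hC.mono (hK hY)).eq_empty_of_disjoint_erase hY

theorem IsTriangleComponent.disjoint (hT : IsTriangleComponent F K T)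
    (hY : InducesMinDegTwo F Y) (hYK : Y ⊆ K) (hu : u ∈ T) (huY : u ∉ Y) : Disjoint Y T := by
  classical
  rw [Finset.disjoint_left]
  intro y hyY hyT
  obtain ⟨a, ⟨haY, hya⟩, b, ⟨hbY, hyb⟩, hab⟩ := hY y hyY
  have hmem : ∀ x ∈ Y, x ∈ T → x ∈ T.erase u := fun x hxY hxT =>
    Finset.mem_erase.mpr ⟨ne_of_mem_of_not_mem hxY huY, hxT⟩
  have hsub : {y, a, b} ⊆ T.erase u := by
    rw [Finset.insert_subset_iff, Finset.insert_subset_iff, Finset.singleton_subset_iff]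
    exact ⟨hmem y hyY hyT, hmem a haY (hT.mem_of_adj hyT (hYK haY) hya),
      hmem b hbY (hT.mem_of_adj hyT (hYK hbY) hyb)⟩
  have hcard := Finset.card_le_card hsub
  rw [Finset.card_eq_three.mpr ⟨y, a, b, F.ne_of_adj hya, F.ne_of_adj hyb, hab, rfl⟩,
    Finset.card_erase_of_mem hu, hT.isNClique.card_eq] at hcard
  lia

/-- Inside `T` a single vertex suffices instead of the at least two vertices of `C`, and outside
`T` one vertex of `C` can be spared. -/
theorem IsTriangleComponent.add_two_le_card (hT : IsTriangleComponent F K T)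
    (hK : K ∈ upperBounds {Y | InducesMinDegTwo F Y})
    (hmin : ∀ B, IsFeedbackVertexSet F B → t ≤ #B) (ht : 2 ≤ t) (hC : IsVertexCoverOn F K C) :
    t + 2 ≤ #C := by
  classical
  obtain ⟨u, hu⟩ : T.Nonempty := Finset.card_pos.mp (by rw [hT.isNClique.card_eq]; norm_num)
  have hfvs : ∀ x, IsFeedbackVertexSet F (insert u ((C \ T).erase x)) := by
    intro x Y hY hYu
    obtain ⟨huY, hYC⟩ := Finset.disjoint_insert_right.mp hYu
    have hYT := hT.disjoint hY (hK hY) hu huY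
    refine IsVertexCoverOn.eq_empty_of_disjoint_erase (fun a ha b hb hab => ?_) hY hYC
    simpa [Finset.disjoint_left.mp hYT ha, Finset.disjoint_left.mp hYT hb] using
      hC a (hK hY ha) b (hK hY hb) hab
  have hT3 := hC.card_le_card_inter_add_one hT.subset hT.isNClique.isClique
  rw [hT.isNClique.card_eq, Finset.inter_comm] at hT3
  have hsplit := Finset.card_sdiff_add_card_inter C T
  rcases (C \ T).eq_empty_or_nonempty with hempty | ⟨x, hx⟩
  · have hone := hmin _ (hfvs u)
    rw [hempty, Finset.erase_empty, Finset.card_insert_of_notMem (Finset.notMem_empty u),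
      Finset.card_empty] at hone
    lia
  · have hle := (hmin _ (hfvs x)).trans (Finset.card_insert_le _ _)
    have herase := Finset.card_erase_add_one hx
    lia

theorem exists_isNClique_three_inter_eq_singleton [DecidableEq W]
    (hK : K ∈ upperBounds {Y | InducesMinDegTwo F Y}) (hB : InducesMaxDegOne F (K \ B))
    (ha : a ∈ B) (hBa : ¬ IsFeedbackVertexSet F (B.erase a)) :
    ∃ T ⊆ K, F.IsNClique 3 T ∧ T ∩ B = {a} := by
  simp only [IsFeedbackVertexSet, not_forall] at hBa
  obtain ⟨Y, hY, hYB, hYne⟩ := hBa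
  have hmem : ∀ y ∈ Y, y ≠ a → y ∈ K \ B := fun y hy hya => Finset.mem_sdiff.mpr
    ⟨hK hY hy, fun hyB => Finset.disjoint_left.mp hYB hy (Finset.mem_erase.mpr ⟨hya, hyB⟩)⟩
  have hadj : ∀ y ∈ Y, y ≠ a → ∀ z ∈ Y, z ≠ a → F.Adj y z →
      a ∈ Y ∧ F.Adj y a := by
    intro y hy hya z hz hza hyz
    obtain ⟨b, hb, hbz, hyb⟩ := hY.exists_adj_ne hy z
    obtain rfl : b = a := by
      by_contra hba
      exact hbz (hB y (hmem y hy hya) ⟨hmem b hb hba, hyb⟩ ⟨hmem z hz hza, hyz⟩)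
    exact ⟨hb, hyb⟩
  obtain ⟨x, hx⟩ := Finset.nonempty_iff_ne_empty.mpr hYne
  obtain ⟨y, hy, hya, -⟩ := hY.exists_adj_ne hx a
  obtain ⟨z, hz, hza, hyz⟩ := hY.exists_adj_ne hy a
  obtain ⟨haY, hya'⟩ := hadj y hy hya z hz hza hyz
  obtain ⟨-, hza'⟩ := hadj z hz hza y hy hya hyz.symm
  obtain ⟨hyK, hyB⟩ := Finset.mem_sdiff.mp (hmem y hy hya)
  obtain ⟨hzK, hzB⟩ := Finset.mem_sdiff.mp (hmem z hz hza)
  refine ⟨{a, y, z}, ?_, SimpleGraph.is3Clique_triple_iff.mpr ⟨hya'.symm, hza'.symm, hyz⟩, ?_⟩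
  · rw [Finset.insert_subset_iff, Finset.insert_subset_iff, Finset.singleton_subset_iff]
    exact ⟨hK hY haY, hyK, hzK⟩
  · rw [Finset.insert_inter_of_mem ha, Finset.insert_inter_of_notMem hyB,
      Finset.singleton_inter_of_notMem hzB, insert_empty_eq]

end

namespace PetalDecomposition

variable {W : Type*} {F : SimpleGraph W} {K C : Finset W} {u v w : W} {s t q : ℕ}
  (D : PetalDecomposition F K t s q)

include D

theorem isVertexCoverOn_core_of_vertices_le_one (hs : s ≤ 1) : IsVertexCoverOn F K D.core := by
  classical
  intro u hu v hv huv
  by_contra! hcore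
  have hpair := D.card_vertices_le v {u, v} (by
    simp only [Finset.forall_mem_insert, Finset.mem_singleton, forall_eq]
    exact ⟨⟨hu, hcore.1, D.rel_of_adj hu hv hcore.1 hcore.2 huv⟩, hv, hcore.2, D.classes.refl v⟩)
  rw [Finset.card_pair huv.ne] at hpair
  lia

theorem isVertexCoverOn_core_of_edges_le_two (hK : InducesMinDegTwo F K) (hq : q ≤ 2) :
    IsVertexCoverOn F K D.core := by
  classical
  intro u hu v hv huv
  by_contra! hcore
  obtain ⟨x, hx, hxv, hux⟩ := hK.exists_adj_ne hu v
  obtain ⟨y, hy, hyu, hvy⟩ := hK.exists_adj_ne hv u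
  have hcard := D.card_edges_le v {s(u, v), s(u, x), s(v, y)} (by
    simp only [Finset.forall_mem_insert, Finset.mem_singleton, forall_eq]
    have huv' := D.rel_of_adj hu hv hcore.1 hcore.2 huv
    exact ⟨⟨u, v, rfl, huv, hu, hv, hcore.1, huv'⟩, ⟨u, x, rfl, hux, hu, hx, hcore.1, huv'⟩,
      ⟨v, y, rfl, hvy, hv, hy, hcore.2, D.classes.refl v⟩⟩)
  have hthree : #{s(u, v), s(u, x), s(v, y)} = 3 := by grind [Sym2.eq_iff, huv.ne, hux.ne, hvy.ne]
  lia

theorem inducesMaxDegOne_of_vertices_le_two [DecidableEq W] (hs : s ≤ 2) :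
    InducesMaxDegOne F (K \ D.core) := by
  rintro u hu v ⟨hv, huv⟩ w ⟨hw, huw⟩
  obtain ⟨huK, huD⟩ := Finset.mem_sdiff.mp hu
  obtain ⟨hvK, hvD⟩ := Finset.mem_sdiff.mp hv
  obtain ⟨hwK, hwD⟩ := Finset.mem_sdiff.mp hw
  by_contra hvw
  have hcard := D.card_vertices_le u {u, v, w} (by
    simp only [Finset.forall_mem_insert, Finset.mem_singleton, forall_eq]
    exact ⟨⟨huK, huD, D.classes.refl u⟩,
      ⟨hvK, hvD, D.classes.symm (D.rel_of_adj huK hvK huD hvD huv)⟩,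
      ⟨hwK, hwD, D.classes.symm (D.rel_of_adj huK hwK huD hwD huw)⟩⟩)
  rw [Finset.card_eq_three.mpr ⟨u, v, w, F.ne_of_adj huv, F.ne_of_adj huw, hvw, rfl⟩] at hcard
  lia

theorem isTriangleComponent_of_edges_le_three [DecidableEq W] (hK : InducesMinDegTwo F K)
    (hq : q ≤ 3) (hu : u ∈ K \ D.core) (hv : v ∈ K \ D.core) (hw : w ∈ K \ D.core)
    (huv : F.Adj u v) (huw : F.Adj u w) (hvw : v ≠ w) : IsTriangleComponent F K {u, v, w} := by
  obtain ⟨huK, huD⟩ := Finset.mem_sdiff.mp hu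
  obtain ⟨hvK, hvD⟩ := Finset.mem_sdiff.mp hv
  obtain ⟨hwK, hwD⟩ := Finset.mem_sdiff.mp hw
  have hT : ∀ x ∈ ({u, v, w} : Finset W), x ∈ K ∧ x ∉ D.core ∧ D.classes x u := by
    simp only [Finset.forall_mem_insert, Finset.mem_singleton, forall_eq]
    exact ⟨⟨huK, huD, D.classes.refl u⟩,
      ⟨hvK, hvD, D.classes.symm (D.rel_of_adj huK hvK huD hvD huv)⟩,
      ⟨hwK, hwD, D.classes.symm (D.rel_of_adj huK hwK huD hwD huw)⟩⟩
  have hcard : ∀ E : Finset (Sym2 W), (∀ e ∈ E, ∃ x ∈ ({u, v, w} : Finset W), ∃ y ∈ K,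
      e = s(x, y) ∧ F.Adj x y) → #E ≤ 3 := fun E hE =>
    (D.card_edges_le u E fun e he => by
      obtain ⟨x, hx, y, hy, rfl, hxy⟩ := hE e he
      exact ⟨x, y, rfl, hxy, (hT x hx).1, hy, (hT x hx).2⟩).trans hq
  have hvw' : F.Adj v w := by
    obtain ⟨x, hx, hxu, hvx⟩ := hK.exists_adj_ne hvK u
    obtain ⟨y, hy, hyu, hwy⟩ := hK.exists_adj_ne hwK u
    by_contra hnot
    have hfour : #{s(u, v), s(u, w), s(v, x), s(w, y)} = 4 := by
      grind [Sym2.eq_iff, huv.ne, huw.ne, hvx.ne, hwy.ne]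
    have := hcard {s(u, v), s(u, w), s(v, x), s(w, y)} (by
      simp only [Finset.forall_mem_insert, Finset.mem_singleton, forall_eq]
      exact ⟨⟨u, by simp, v, hvK, rfl, huv⟩, ⟨u, by simp, w, hwK, rfl, huw⟩,
        ⟨v, by simp, x, hx, rfl, hvx⟩, ⟨w, by simp, y, hy, rfl, hwy⟩⟩)
    lia
  refine ⟨fun x hx => (hT x hx).1, SimpleGraph.is3Clique_triple_iff.mpr ⟨huv, huw, hvw'⟩, ?_⟩
  intro x y hx hy hxy
  by_contra hyT
  have hfour : #{s(u, v), s(u, w), s(v, w), s(x, y)} = 4 := by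
    grind [Sym2.eq_iff, huv.ne, huw.ne, hxy.ne]
  have := hcard {s(u, v), s(u, w), s(v, w), s(x, y)} (by
    simp only [Finset.forall_mem_insert, Finset.mem_singleton, forall_eq]
    exact ⟨⟨u, by simp, v, hvK, rfl, huv⟩, ⟨u, by simp, w, hwK, rfl, huw⟩,
      ⟨v, by simp, w, hwK, rfl, hvw'⟩, ⟨x, hx, y, hy, rfl, hxy⟩⟩)
  lia

theorem disjoint_of_isNClique_three [DecidableEq W] {a b : W} {S T : Finset W}
    (hm : InducesMaxDegOne F (K \ D.core)) (hq : q ≤ 4) (hab : a ≠ b)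
    (hSK : S ⊆ K) (hS : F.IsNClique 3 S) (hSa : S ∩ D.core = {a})
    (hTK : T ⊆ K) (hT : F.IsNClique 3 T) (hTb : T ∩ D.core = {b}) : Disjoint S T := by
  rw [Finset.disjoint_left]
  intro x hxS hxT
  have hxD : x ∉ D.core := fun hx => hab <| Eq.trans
    (Finset.mem_singleton.mp (hSa ▸ Finset.mem_inter.mpr ⟨hxS, hx⟩)).symm
    (Finset.mem_singleton.mp (hTb ▸ Finset.mem_inter.mpr ⟨hxT, hx⟩))
  have hmate : ∀ {R : Finset W} {c : W}, F.IsNClique 3 R → R ∩ D.core = {c} →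
      ∃ m ∈ R \ D.core, m ≠ x := fun {R c} hR hRc => Finset.exists_mem_ne (by
    have := Finset.card_sdiff_add_card_inter R D.core
    rw [hRc, hR.card_eq, Finset.card_singleton] at this
    lia) x
  obtain ⟨m, hmS, hmx⟩ := hmate hS hSa
  obtain ⟨m', hmT, hmx'⟩ := hmate hT hTb
  obtain ⟨hmS, hmD⟩ := Finset.mem_sdiff.mp hmS
  obtain ⟨hmT, hmD'⟩ := Finset.mem_sdiff.mp hmT
  have hxm := hS.isClique hxS hmS hmx.symm
  obtain rfl : m = m' := hm x (Finset.mem_sdiff.mpr ⟨hSK hxS, hxD⟩)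
    ⟨Finset.mem_sdiff.mpr ⟨hSK hmS, hmD⟩, hxm⟩
    ⟨Finset.mem_sdiff.mpr ⟨hTK hmT, hmD'⟩, hT.isClique hxT hmT hmx'.symm⟩
  obtain ⟨haS, haD⟩ := Finset.mem_inter.mp (hSa ▸ Finset.mem_singleton_self a)
  obtain ⟨hbT, hbD⟩ := Finset.mem_inter.mp (hTb ▸ Finset.mem_singleton_self b)
  have hne : x ≠ a ∧ m ≠ a ∧ x ≠ b ∧ m ≠ b :=
    ⟨(haD.ne_of_notMem hxD).symm, (haD.ne_of_notMem hmD).symm, (hbD.ne_of_notMem hxD).symm,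
      (hbD.ne_of_notMem hmD).symm⟩
  have hfive : #{s(x, m), s(x, a), s(m, a), s(x, b), s(m, b)} = 5 := by grind [Sym2.eq_iff]
  have hmclass := D.classes.symm (D.rel_of_adj (hSK hxS) (hSK hmS) hxD hmD hxm)
  have := D.card_edges_le x {s(x, m), s(x, a), s(m, a), s(x, b), s(m, b)} (by
    simp only [Finset.forall_mem_insert, Finset.mem_singleton, forall_eq]
    exact ⟨⟨x, m, rfl, hxm, hSK hxS, hSK hmS, hxD, D.classes.refl x⟩,
      ⟨x, a, rfl, hS.isClique hxS haS hne.1, hSK hxS, hSK haS, hxD, D.classes.refl x⟩,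
      ⟨m, a, rfl, hS.isClique hmS haS hne.2.1, hSK hmS, hSK haS, hmD, hmclass⟩,
      ⟨x, b, rfl, hT.isClique hxT hbT hne.2.2.1, hSK hxS, hTK hbT, hxD, D.classes.refl x⟩,
      ⟨m, b, rfl, hT.isClique hmT hbT hne.2.2.2, hSK hmS, hTK hbT, hmD, hmclass⟩⟩)
  lia

theorem two_mul_le_card [DecidableEq W] (hK : K ∈ upperBounds {Y | InducesMinDegTwo F Y})
    (hmin : ∀ B, IsFeedbackVertexSet F B → t ≤ #B) (hm : InducesMaxDegOne F (K \ D.core))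
    (hq : q ≤ 4) (hC : IsVertexCoverOn F K C) : 2 * t ≤ #C := by
  have hcore : #D.core = t :=
    D.card_core_le.antisymm (hmin _ (isFeedbackVertexSet_of_inducesMaxDegOne hK hm))
  have herase : ∀ a ∈ D.core, ¬ IsFeedbackVertexSet F (D.core.erase a) := fun a ha hfvs => by
    have := hmin _ hfvs
    have := Finset.card_erase_lt_of_mem ha
    lia
  choose! T hTK hT hTcore using fun a (ha : a ∈ D.core) =>
    exists_isNClique_three_inter_eq_singleton hK hm ha (herase a ha)
  have htwo : ∀ a ∈ D.core, 2 ≤ #(T a ∩ C) := fun a ha => by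
    have := hC.card_le_card_inter_add_one (hTK a ha) (hT a ha).isClique
    rw [(hT a ha).card_eq] at this
    lia
  have hdisj : (D.core : Set W).PairwiseDisjoint fun a => T a ∩ C := fun a ha b hb hab =>
    (D.disjoint_of_isNClique_three hm hq hab (hTK a ha) (hT a ha) (hTcore a ha) (hTK b hb)
      (hT b hb) (hTcore b hb)).mono Finset.inter_subset_left Finset.inter_subset_left
  calc 2 * t = #D.core • 2 := by rw [hcore, smul_eq_mul, mul_comm]
    _ ≤ ∑ a ∈ D.core, #(T a ∩ C) := Finset.card_nsmul_le_sum _ _ _ htwo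
    _ = #(D.core.biUnion fun a => T a ∩ C) := (Finset.card_biUnion hdisj).symm
    _ ≤ #C := Finset.card_le_card (Finset.biUnion_subset.mpr fun _ _ => Finset.inter_subset_right)

end PetalDecomposition

/-! ### Saturated hypergraphs of linear size for `k ≤ 5` -/

theorem exists_injective_card_eq_mem {r t : ℕ} (hr : 0 < r) (hrt : r = 1 ∨ r < t) :
    ∃ S : Fin t → Finset (Fin t), Function.Injective S ∧ (∀ a, #(S a) = r) ∧ ∀ a, a ∈ S a := by
  rcases hrt with rfl | hrt
  · exact ⟨fun a => {a}, Finset.singleton_injective, Finset.card_singleton,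
      Finset.mem_singleton_self⟩
  obtain ⟨n, rfl⟩ := Nat.exists_eq_succ_of_ne_zero (Nat.ne_zero_of_lt hrt)
  -- Cyclic intervals: the first element `a` of `S a` is the only one whose predecessor is missing.
  let I : Finset (Fin (n + 1)) := {i | i.val < r}
  let S : Fin (n + 1) → Finset (Fin (n + 1)) := fun a => I.map (addLeftEmbedding a)
  have hS : ∀ {a x}, x ∈ S a ↔ (x - a).val < r := by
    intro a x
    simp only [S, I, Finset.mem_map, Finset.mem_filter_univ, addLeftEmbedding_apply]
    exact ⟨by rintro ⟨i, hi, rfl⟩; simpa using hi, fun h => ⟨x - a, h, add_sub_cancel a x⟩⟩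
  have hself : ∀ a, a ∈ S a := fun a => hS.mpr (by simpa using hr)
  refine ⟨S, fun a b hab => ?_, fun a => ?_, hself⟩
  · by_contra hne
    have hmem : a ∈ S b := hab ▸ hself a
    have hpred : a - 1 ∉ S b := by
      rw [← hab, hS, sub_sub_cancel_left, not_lt, Fin.coe_neg_one]
      exact Nat.lt_succ_iff.mp hrt
    rw [hS, show a - 1 - b = a - b - 1 by abel, Fin.coe_sub_one, if_neg (sub_ne_zero.mpr hne)]
      at hpred
    exact hpred ((Nat.sub_le _ _).trans_lt (hS.mp hmem))
  · rw [Finset.card_map, Fin.card_filter_val_lt, min_eq_right hrt.le]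

theorem hasTransversals_two_triples :
    HasTransversals 2 (![{0, 1, 2}, {0, 1, 3}] : Fin 2 → Finset (Fin 4)) := by
  simp only [HasTransversals, Set.InjOn, Finset.mem_coe]
  decide

section

variable {W : Type*} {F : SimpleGraph W} {A C K T : Finset W} {v : W} {k r s t : ℕ}

theorem exists_minimum_isFeedbackVertexSet_subset
    (hK : K ∈ upperBounds {Y | InducesMinDegTwo F Y}) :
    ∃ A ⊆ K, IsFeedbackVertexSet F A ∧ ∀ B, IsFeedbackVertexSet F B → #A ≤ #B := by
  classical
  obtain ⟨A, hA⟩ := exists_minimalFor_of_wellFoundedLT (IsFeedbackVertexSet F) Finset.card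
    ⟨K, fun Y hY hYK => hYK.eq_bot_of_le (hK hY)⟩
  exact ⟨A ∩ K, Finset.inter_subset_right, hA.prop.inter hK, fun B hB =>
    (Finset.card_le_card Finset.inter_subset_left).trans (hA.le hB)⟩

theorem exists_minimum_isVertexCoverOn (F : SimpleGraph W) (K : Finset W) :
    ∃ C, IsVertexCoverOn F K C ∧ ∀ B, IsVertexCoverOn F K B → #C ≤ #B := by
  obtain ⟨C, hC⟩ := exists_minimalFor_of_wellFoundedLT (IsVertexCoverOn F K) Finset.card
    ⟨K, fun u hu _ _ _ => Or.inl hu⟩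
  exact ⟨C, hC.prop, fun B hB => hC.le hB⟩

theorem IsVertexCoverOn.lt_card (hC : IsVertexCoverOn F K C)
    (hK : K ∈ upperBounds {Y | InducesMinDegTwo F Y})
    (hmin : ∀ B, IsFeedbackVertexSet F B → t ≤ #B) (ht : 0 < t) : t < #C := by
  classical
  have hCF : IsFeedbackVertexSet F C := fun Y hY hYC =>
    Y.eq_empty_or_nonempty.elim id fun ⟨y, _⟩ => (hC.mono (hK hY)).eq_empty_of_disjoint_erase hY
      (hYC.mono_right (Finset.erase_subset y C))
  obtain ⟨x, hx⟩ : C.Nonempty := Finset.card_pos.mp (ht.trans_le (hmin C hCF))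
  exact (hmin _ (hC.isFeedbackVertexSet_erase hK x)).trans_lt (Finset.card_erase_lt_of_mem hx)

theorem IsTriangleComponent.card_le_two_of_forall_adj (hT : IsTriangleComponent F K T)
    (hA : IsFeedbackVertexSet F A) (hAK : A ⊆ K) (hv : v ∈ K) (hvA : ∀ a ∈ A, F.Adj v a) :
    #A ≤ 2 := by
  classical
  have hTA : ¬ Disjoint T A := fun hdisj => by
    have hempty := hA T (inducesMinDegTwo_of_isClique hT.isNClique.isClique
      hT.isNClique.card_eq.ge) hdisj
    simpa [hempty] using hT.isNClique.card_eq
  obtain ⟨a, haT, haA⟩ := Finset.not_disjoint_iff.mp hTA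
  have hvT := hT.mem_of_adj haT hv (hvA a haA).symm
  have hsub : A ⊆ T.erase v := fun b hb => Finset.mem_erase.mpr
    ⟨(hvA b hb).ne', hT.mem_of_adj hvT (hAK hb) (hvA b hb)⟩
  have hcard := Finset.card_le_card hsub
  rwa [Finset.card_erase_of_mem hvT, hT.isNClique.card_eq] at hcard

variable [Finite W]

theorem hasLinearSaturation_of_isEmpty_petalDecomposition_self (hk : 2 ≤ k) (hrs : r + s = k)
    (hr : 0 < r) (hs : 0 < s) (hrt : r = 1 ∨ r < t) (ht : 0 < t) (hA : IsFeedbackVertexSet F A)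
    (hAt : #A ≤ t) (hK : InducesMinDegTwo F K) (hdecomp : IsEmpty (PetalDecomposition F K t s t)) :
    HasLinearSaturation k F := by
  have := Fin.pos_iff_nonempty.mp ht
  obtain ⟨S, hinj, hcard, hmem⟩ := exists_injective_card_eq_mem hr hrt
  refine hasLinearSaturation_of_isEmpty_petalDecomposition (d := t) hk hs hinj
    (fun i => by rw [hcard, hrs]) (fun Q _ => ⟨id, Set.injOn_id _, fun a _ => hmem a⟩) hA
    (hAt.trans_eq (Fintype.card_fin t).symm)
    (fun v _ Q hQ _ => (Finset.card_le_card hQ).trans hAt) hK ?_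
  rwa [Fintype.card_fin]

theorem hasLinearSaturation_of_card_feedbackVertexSet_le_two (hk : 2 ≤ k)
    (hK : InducesMinDegTwo F K) (hA : IsFeedbackVertexSet F A) (hA0 : A.Nonempty) (hA2 : #A ≤ 2)
    (hAC : ∀ C, IsVertexCoverOn F K C → #A < #C) : HasLinearSaturation k F :=
  hasLinearSaturation_of_isEmpty_petalDecomposition_self (r := 1) (s := k - 1) hk (by lia) one_pos
    (by lia) (Or.inl rfl) hA0.card_pos hA le_rfl hK ⟨fun D =>
      (hAC _ (D.isVertexCoverOn_core_of_edges_le_two hK hA2)).not_ge D.card_core_le⟩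

theorem hasLinearSaturation_of_lt_card_vertexCover (hk : 2 ≤ k)
    (hK : IsGreatest {Y | InducesMinDegTwo F Y} K) (hC : IsVertexCoverOn F K C)
    (hCmin : ∀ B, IsVertexCoverOn F K B → #C ≤ #B) (hkC : k < #C) : HasLinearSaturation k F := by
  classical
  obtain ⟨x, hx⟩ : C.Nonempty := Finset.card_pos.mp (by lia)
  have hcard := Finset.card_erase_add_one hx
  refine hasLinearSaturation_of_isEmpty_petalDecomposition_self (r := k - 1) (s := 1) hk (by lia)
    (by lia) one_pos (Or.inr (by lia)) (by lia) (hC.isFeedbackVertexSet_erase hK.2 x) le_rfl hK.1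
    ⟨fun D => ?_⟩
  have hle := (hCmin _ (D.isVertexCoverOn_core_of_vertices_le_one le_rfl)).trans D.card_core_le
  lia

theorem IsTriangleComponent.hasLinearSaturation_five (hT : IsTriangleComponent F K T)
    (hK : IsGreatest {Y | InducesMinDegTwo F Y} K) (hAK : A ⊆ K) (hA : IsFeedbackVertexSet F A)
    (hA3 : #A ≤ 3) (hC : ∀ C, IsVertexCoverOn F K C → 4 < #C) : HasLinearSaturation 5 F := by
  have hd : ∀ v ∉ A, ∀ Q ⊆ A, (∀ a ∈ Q, F.Adj v a) → #Q ≤ 2 := by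
    intro v _ Q hQA hvQ
    by_cases hv : v ∈ K
    · by_contra! hQ
      obtain rfl := Finset.eq_of_subset_of_card_le hQA (hA3.trans hQ)
      exact hQ.not_ge (hT.card_le_two_of_forall_adj hA hAK hv hvQ)
    · exact (card_le_one_of_forall_adj_of_notMem hK hv (hQA.trans hAK) hvQ).trans one_le_two
  refine hasLinearSaturation_of_isEmpty_petalDecomposition (s := 2) (by norm_num) two_pos
    (by decide) (by decide) hasTransversals_two_triples hA
    (hA3.trans (by simp)) hd hK.1 ⟨fun D => ?_⟩
  exact (hC _ (D.isVertexCoverOn_core_of_edges_le_two hK.1 le_rfl)).not_ge D.card_core_le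

theorem hasLinearSaturation_of_card_feedbackVertexSet_le_four (hk : k ≤ 5)
    (hK : IsGreatest {Y | InducesMinDegTwo F Y} K) (hA : IsFeedbackVertexSet F A)
    (hmin : ∀ B, IsFeedbackVertexSet F B → #A ≤ #B) (hA3 : 3 ≤ #A) (hA4 : #A ≤ 4) (hAk : #A ≤ k)
    (hC : IsVertexCoverOn F K C) (hCA : #C < 2 * #A) (hT : ∀ T, ¬ IsTriangleComponent F K T) :
    HasLinearSaturation k F := by
  classical
  refine hasLinearSaturation_of_isEmpty_petalDecomposition_self (r := #A - 1)
    (s := k - (#A - 1)) (by lia) (by lia) (by lia) (by lia) (Or.inr (by lia)) (by lia) hA le_rfl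
    hK.1 ⟨fun D => ?_⟩
  have hmatching : InducesMaxDegOne F (K \ D.core) := by
    rcases hA3.eq_or_lt with hA3 | hA4
    · rintro u hu v ⟨hv, huv⟩ w ⟨hw, huw⟩
      by_contra hvw
      exact hT _ (D.isTriangleComponent_of_edges_le_three hK.1 hA3.ge hu hv hw huv huw hvw)
    · exact D.inducesMaxDegOne_of_vertices_le_two (by lia)
  exact hCA.not_ge (D.two_mul_le_card hK.2 hmin hmatching hA4 hC)

theorem hasLinearSaturation_of_le_five (hF : F ≠ ⊥) (hk2 : 2 ≤ k) (hk5 : k ≤ 5) :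
    HasLinearSaturation k F := by
  classical
  obtain ⟨K, hK⟩ := exists_isGreatest_inducesMinDegTwo F
  obtain ⟨A, hAK, hA, hmin⟩ := exists_minimum_isFeedbackVertexSet_subset hK.2
  obtain ⟨C, hC, hCmin⟩ := exists_minimum_isVertexCoverOn F K
  rcases A.eq_empty_or_nonempty with rfl | hA0
  · exact hasLinearSaturation_of_isFeedbackVertexSet_empty hF hA
  have hAC : ∀ B, IsVertexCoverOn F K B → #A < #B := fun B hB => hB.lt_card hK.2 hmin hA0.card_pos
  rcases le_or_gt #A 2 with hA2 | hA3
  · exact hasLinearSaturation_of_card_feedbackVertexSet_le_two hk2 hK.1 hA hA0 hA2 hAC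
  rcases lt_or_ge k #C with hkC | hCk
  · exact hasLinearSaturation_of_lt_card_vertexCover hk2 hK hC hCmin hkC
  have hACmin := hAC C hC
  by_cases hT : ∃ T, IsTriangleComponent F K T
  · obtain ⟨T, hT⟩ := hT
    have hadd := hT.add_two_le_card hK.2 hmin hA3.le hC
    obtain rfl : k = 5 := by lia
    exact hT.hasLinearSaturation_five hK hAK hA (by lia) fun B hB => by
      have := hCmin B hB
      lia
  · exact hasLinearSaturation_of_card_feedbackVertexSet_le_four hk5 hK hA hmin hA3 (by lia)
      (by lia) hC (by lia) (not_exists.mp hT)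

end

theorem mainTheorem1_general {W : Type*} [Finite W] (F : SimpleGraph W) (hF : F ≠ ⊥)
    (k : ℕ) (hk2 : 2 ≤ k) (hk5 : k ≤ 5) :
    (∀ n : ℕ, ∃ H : UniformHypergraph k (Fin n), H.IsBergeSaturated F) ∧
      (fun n : ℕ => (bergeSat k n F : ℝ)) =O[atTop] (fun n : ℕ => (n : ℝ)) := by
  refine ⟨fun n => ?_, ?_⟩
  · obtain ⟨H, -, hH⟩ := UniformHypergraph.exists_isBergeSaturated_of_not_containsBerge
      (UniformHypergraph.not_containsBerge_of_edges_eq_empty hF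
        (H := (⟨∅, by simp⟩ : UniformHypergraph k (Fin n))) rfl)
    exact ⟨H, hH⟩
  · obtain ⟨C, hC⟩ := hasLinearSaturation_of_le_five hF hk2 hk5
    refine IsBigO.of_bound C (hC.mono fun n hn => ?_)
    obtain ⟨H, hH, hcard⟩ := hn
    have hmin : bergeSat k n F ≤ #H.edges := Nat.sInf_le ⟨H, hH, rfl⟩
    have hle : bergeSat k n F ≤ C * n := hmin.trans hcard
    simpa using (by exact_mod_cast hle : (bergeSat k n F : ℝ) ≤ C * n)

theorem mainTheorem1 {W : Type*} [Finite W] (F : SimpleGraph W) (hF : F ≠ ⊥)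
    (k : ℕ) (hk3 : 3 ≤ k) (hk5 : k ≤ 5) :
    (∀ n : ℕ, ∃ H : UniformHypergraph k (Fin n), H.IsBergeSaturated F) ∧
      (fun n : ℕ => (bergeSat k n F : ℝ)) =O[atTop] (fun n : ℕ => (n : ℝ)) :=
  mainTheorem1_general F hF k (by lia) hk5
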